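/- Let $G$ be an amenable locally compact (Hausdorff) group with a right Haar measure $\mu$, let $X$ be a complex Banach space, let $1<p<\infty$, and let $\pi\colon G\to\mathcal{B}(X)$ be a representation (so $\pi(st)=\pi(s)\pi(t)$ and $\pi(e)=\mathrm{Id}_X$) which is continuous, i.e. $t\mapsto\pi(t)x$ is continuous for every $x\in X$, and bounded, i.e. $\|\pi\|:=\sup_{t\in G}\|\pi(t)\|<\infty$. Let $\kappa_X\colon X\to X^{**}$ be the canonical embedding. For an ultrafilter $\mathcal{U}$ on a set $I$ and a Banach space $E$, the ultrapower $E^{\mathcal U}$ is the quotient of $\ell^\infty(I;E)$ by the closed subspace of all families $(x_i)_{i\in I}$ with $\lim_{\mathcal U}\|x_i\|=0$. Then there exist an ultrafilter $\mathcal{U}$ on some set $I$ and, with $Y=L^p(G,\mu;X)^{\mathcal U}$, a (not necessarily continuous) representation $\widehat\pi\colon G\to\mathcal{B}(Y)$ such that each $\widehat\pi(t)$ is an isometry, and bounded operators $J\colon X\to Y$ and $Q\colon Y\to X^{**}$, such that 1. $\|J\|\,\|Q\|\le\|\pi\|^2$ and $\kappa_X\pi(t)=Q\,\widehat\pi(t)\,J$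 for all $t\in G$; 2. for every $x\in X$, the map $t\mapsto\widehat\pi(t)J(x)$ from $G$ to $Y$ is continuous; 3. if $X$ is a Riesz-normed space, then $Y$ is a Riesz-normed space as well and every $\widehat\pi(t)$ is a positive operator on $Y$. Here a complex Banach space $E$ is the complexification of a closed real subspace $E_{\mathbb R}$ if $E=E_{\mathbb R}\oplus iE_{\mathbb R}$ and $\max\{\|x\|,\|y\|\}\le\|x+iy\|$ for $x,y\in E_{\mathbb R}$. It is an ordered Banach space if, moreover, $E_{\mathbb R}$ carries a partial order compatible with its vector space structure whose positive cone $C$ is closed and satisfies $C\cap(-C)=\{0\}$; an operator is positive if it maps $C$ into $C$. It is Riesz-normed if, moreover, $-y\le x\le y$ implies $\|x\|\le\|y\|$ for $x,y\in E_{\mathbb R}$, and for all $x\in E_{\mathbb R}$ and $\varepsilon>0$ there is $y\in E_{\mathbb R}$ with $-y\le x\le y$ and $\|y\|\le(1+\varepsilon)\|x\|$. In 3., the real part (resp. the positive cone) of $L^p(G,\mu;X)$ consists of the functions with values almost everywhere in the real part (resp. the positive cone) of $X$, and the real part (resp. the positive cone) of $Y$ consists of the classes of bounded families of elements of the real part (resp.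 the positive cone) of $L^p(G,\mu;X)$. -/

import Mathlib

open MeasureTheory Filter Topology
open scoped ENNReal BoundedContinuousFunction

set_option maxSynthPendingDepth 3

universe u v

namespace GroupDilation

/-! ### Amenability -/

/-- The left translate `t ↦ f (s * t)` of a bounded continuous real function on a topological
group. -/
noncomputable def leftTranslate {G : Type*} [Group G] [TopologicalSpace G] [IsTopologicalGroup G]
    (s : G) (f : G →ᵇ ℝ) : G →ᵇ ℝ :=
  f.compContinuous ⟨fun t => s * t, continuous_const_mul s⟩

/-- A (locally compact) group is amenable if there is a left-invariant mean on the space of bounded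
continuous functions: a positive normalized linear functional that is invariant under left
translations. (A left-invariant mean on `L^∞(G)` restricts to such a functional.) -/
def IsAmenable (G : Type*) [Group G] [TopologicalSpace G] [IsTopologicalGroup G] : Prop :=
  ∃ m : (G →ᵇ ℝ) →ₗ[ℝ] ℝ,
    m (BoundedContinuousFunction.const G 1) = 1 ∧
    (∀ f : G →ᵇ ℝ, (∀ t, 0 ≤ f t) → 0 ≤ m f) ∧
    ∀ (s : G) (f : G →ᵇ ℝ), m (leftTranslate s f) = m f

/-! ### Ultraproducts of Banach spaces -/

section Ultraproduct

variable {I : Type*} (𝒰 : Ultrafilter I) (E : I → Type*)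
  [∀ j, NormedAddCommGroup (E j)] [∀ j, NormedSpace ℂ (E j)]

/-- The subspace of `ℓ^∞(I; E_j)` of all bounded families whose norms tend to `0` along the
ultrafilter `𝒰`. -/
noncomputable def nullFamilies : Submodule ℂ (lp E ∞) where
  carrier := {x | Tendsto (fun j => ‖x j‖) 𝒰 (𝓝 0)}
  zero_mem' := by simp
  add_mem' := by
    intro x y hx hy
    have h := Tendsto.add hx hy
    rw [add_zero] at h
    exact squeeze_zero (fun j => norm_nonneg _) (fun j => norm_add_le (x j) (y j)) h
  smul_mem' := by
    intro c x hx
    have h := Tendsto.const_mul ‖c‖ hx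
    rw [mul_zero] at h
    exact squeeze_zero (fun j => norm_nonneg _) (fun j => (norm_smul c (x j)).le) h

instance isClosed_nullFamilies : IsClosed (nullFamilies 𝒰 E : Set (lp E ∞)) := by
  rw [← isSeqClosed_iff_isClosed]
  intro u x hu hx
  change Tendsto (fun j => ‖x j‖) 𝒰 (𝓝 0)
  rw [Metric.tendsto_nhds]
  intro ε hε
  obtain ⟨n, hn⟩ := ((Metric.tendsto_nhds.1 hx) (ε / 2) (half_pos hε)).exists
  filter_upwards [(Metric.tendsto_nhds.1 (hu n)) (ε / 2) (half_pos hε)] with j hj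
  rw [Real.dist_eq, sub_zero, abs_of_nonneg (norm_nonneg _)] at hj ⊢
  have h1 : ‖(u n - x) j‖ ≤ ‖u n - x‖ := lp.norm_apply_le_norm ENNReal.top_ne_zero _ j
  have h2 : ‖x j‖ ≤ ‖(u n) j‖ + ‖(u n - x) j‖ := by
    have h3 : x j = (u n) j - (u n - x) j := by simp
    calc ‖x j‖ = ‖(u n) j - (u n - x) j‖ := by rw [← h3]
      _ ≤ _ := norm_sub_le _ _
  rw [dist_eq_norm] at hn
  linarith

/-- The ultraproduct `(E_j)^𝒰 = ℓ^∞(I; E_j) / N_𝒰`, a normed space for the quotient norm. -/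
def Ultraproduct : Type _ := lp E ∞ ⧸ nullFamilies 𝒰 E

namespace Ultraproduct

noncomputable instance : NormedAddCommGroup (Ultraproduct 𝒰 E) :=
  inferInstanceAs (NormedAddCommGroup (lp E ∞ ⧸ nullFamilies 𝒰 E))

noncomputable instance : NormedSpace ℂ (Ultraproduct 𝒰 E) :=
  inferInstanceAs (NormedSpace ℂ (lp E ∞ ⧸ nullFamilies 𝒰 E))

instance [∀ j, CompleteSpace (E j)] : CompleteSpace (Ultraproduct 𝒰 E) :=
  inferInstanceAs (CompleteSpace (lp E ∞ ⧸ nullFamilies 𝒰 E))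

/-- The canonical map that sends a bounded family to its class. -/
noncomputable def mk : lp E ∞ →ₗ[ℂ] Ultraproduct 𝒰 E := (nullFamilies 𝒰 E).mkQ

end Ultraproduct

end Ultraproduct

/-! ### Riesz-normed spaces -/

/-- The data of a "real part" and of a "positive cone" on a set. -/
@[ext]
structure OrderData (E : Type*) where
  /-- the real part `E_ℝ` -/
  re : Set E
  /-- the positive cone -/
  cone : Set E

namespace OrderData

section Predicates

variable {E : Type*} [NormedAddCommGroup E] [NormedSpace ℂ E] (D : OrderData E)

/-- `E` is the complexification of the real Banach space `D.re`. -/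
structure IsComplexification : Prop where
  complete : CompleteSpace E
  zero_mem : (0 : E) ∈ D.re
  add_mem : ∀ x ∈ D.re, ∀ y ∈ D.re, x + y ∈ D.re
  smul_mem : ∀ (r : ℝ), ∀ x ∈ D.re, (r : ℂ) • x ∈ D.re
  isClosed : IsClosed D.re
  exists_decomp : ∀ z : E, ∃ x ∈ D.re, ∃ y ∈ D.re, z = x + Complex.I • y
  decomp_unique : ∀ x ∈ D.re, ∀ y ∈ D.re, ∀ x' ∈ D.re, ∀ y' ∈ D.re,
    x + Complex.I • y = x' + Complex.I • y' → x = x' ∧ y = y'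
  max_norm_le : ∀ x ∈ D.re, ∀ y ∈ D.re, max ‖x‖ ‖y‖ ≤ ‖x + Complex.I • y‖

/-- `E` is an ordered Banach space: it is the complexification of the real Banach space `D.re`,
which carries the partial order `x ≤ y ↔ y - x ∈ D.cone`, and the cone is closed and proper. -/
structure IsOrderedBanach : Prop extends D.IsComplexification where
  cone_subset : D.cone ⊆ D.re
  zero_mem_cone : (0 : E) ∈ D.cone
  add_mem_cone : ∀ x ∈ D.cone, ∀ y ∈ D.cone, x + y ∈ D.cone
  smul_mem_cone : ∀ (r : ℝ), 0 ≤ r → ∀ x ∈ D.cone, (r : ℂ) • x ∈ D.cone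
  isClosed_cone : IsClosed D.cone
  cone_proper : ∀ x, x ∈ D.cone → -x ∈ D.cone → x = 0

/-- The order on the real part defined by the cone. -/
def Le (x y : E) : Prop := y - x ∈ D.cone

/-- `E` is a Riesz-normed space: an ordered Banach space such that `-y ≤ x ≤ y` implies
`‖x‖ ≤ ‖y‖`, and such that any `x` in the real part satisfies `-y ≤ x ≤ y` for some `y` in the real
part with `‖y‖ ≤ (1 + ε) ‖x‖`, for every `ε > 0`. -/
structure IsRieszNormed : Prop extends D.IsOrderedBanach where
  absolutely_monotone : ∀ x ∈ D.re, ∀ y ∈ D.re, D.Le (-y) x → D.Le x y → ‖x‖ ≤ ‖y‖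
  exists_dominating : ∀ x ∈ D.re, ∀ ε : ℝ, 0 < ε →
    ∃ y ∈ D.re, D.Le (-y) x ∧ D.Le x y ∧ ‖y‖ ≤ (1 + ε) * ‖x‖

/-- The operator `T` is positive: it maps positive elements to positive elements. -/
def IsPositiveOperator (T : E →L[ℂ] E) : Prop := ∀ x ∈ D.cone, T x ∈ D.cone

end Predicates

/-- The order structure of the Bochner space `L^p(μ; E)`: the real part (resp. the positive cone)
consists of the (classes of) functions with values a.e. in the real part (resp. in the cone)
of `E`. -/
def bochner {E : Type*} [NormedAddCommGroup E] (D : OrderData E) {Ω : Type*} [MeasurableSpace Ω]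
    (p : ℝ≥0∞) (μ : Measure Ω) : OrderData (Lp E p μ) where
  re := {f | ∀ᵐ t ∂μ, f t ∈ D.re}
  cone := {f | ∀ᵐ t ∂μ, f t ∈ D.cone}

/-- The order structure of an ultraproduct: the real part (resp. the positive cone)
consists of the classes of the bounded families of real (resp. of positive) elements. -/
def ultraproduct {I : Type*} (𝒰 : Ultrafilter I) {E : I → Type*}
    [∀ j, NormedAddCommGroup (E j)] [∀ j, NormedSpace ℂ (E j)] (D : ∀ j, OrderData (E j)) :
    OrderData (Ultraproduct 𝒰 E) where
  re := {z | ∃ x : lp E ∞, (∀ j, x j ∈ (D j).re) ∧ Ultraproduct.mk 𝒰 E x = z}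
  cone := {z | ∃ x : lp E ∞, (∀ j, x j ∈ (D j).cone) ∧ Ultraproduct.mk 𝒰 E x = z}

end OrderData

end GroupDilation

/-! For a continuous compactly supported probability density φ and 1/p + 1/q = 1, put J_φ x =
φ^{1/p} π(·)x and Q_φ f = ∫ φ(s)^{1/q} π(s⁻¹) f(s) ds. Both have norm at most ‖π‖ (Hölder for Q_φ),
and Q_φ J_φ = Id, since the weights multiply to φ and π(s⁻¹)π(s) = Id.

Right translation R_t on L^p is isometric and preserves almost everywhere positivity. It almost
intertwines: R_t J_φ x and J_φ π(t)x carry the same vector π(st)x at s with weights φ(st)^{1/p} and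
φ(s)^{1/p}, so they differ in norm by at most ‖π‖ ‖x‖ ‖φ(·t) − φ‖₁^{1/p}. Amenability makes the last
factor small for finitely many t at once (`exists_isDensity_integral_translate_sub_le`, by Day's
convexity argument).

Along an ultrafilter the error vanishes: in the ultrapower π̂(t)J = Jπ(t) exactly, while the
weak-star limit Q of the Q_φ satisfies QJ = κ_X. The factorization Qπ̂(t)J = κ_X π(t) and the
continuity of t ↦ π̂(t)Jx follow (`exists_intertwining_ultrapowerTranslation`).

The order statement is separate: Riesz-normed spaces are stable under L^p (`IsRieszNormed.bochner`,
through simple functions) and under ultraproducts (`IsRieszNormed.ultraproduct`, through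
representatives). -/

namespace GroupDilation

/-! ### Norms, operators and weak-star limits on ultraproducts. -/

/-- A uniformly bounded family, as an element of `ℓ^∞`. -/
def boundedFamily {I : Type*} {E : I → Type*} [∀ j, NormedAddCommGroup (E j)]
    (x : ∀ j, E j) (C : ℝ) (h : ∀ j, ‖x j‖ ≤ C) : lp E ∞ :=
  ⟨x, memℓp_infty ⟨C, by rintro _ ⟨j, rfl⟩; exact h j⟩⟩

@[simp]
theorem boundedFamily_apply {I : Type*} {E : I → Type*} [∀ j, NormedAddCommGroup (E j)]
    (x : ∀ j, E j) (C : ℝ) (h : ∀ j, ‖x j‖ ≤ C) (j : I) : boundedFamily x C h j = x j := rfl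

namespace Ultraproduct

section Norm

variable {I : Type*} (𝒰 : Ultrafilter I) {E : I → Type*}
  [∀ j, NormedAddCommGroup (E j)] [∀ j, NormedSpace ℂ (E j)]

theorem mk_surjective : Function.Surjective (mk 𝒰 E) := (nullFamilies 𝒰 E).mkQ_surjective

theorem norm_mk_le (x : lp E ∞) : ‖mk 𝒰 E x‖ ≤ ‖x‖ :=
  Submodule.Quotient.norm_mk_le (nullFamilies 𝒰 E) x

theorem mk_eq_zero_iff {x : lp E ∞} : mk 𝒰 E x = 0 ↔ Tendsto (fun j => ‖x j‖) 𝒰 (𝓝 0) :=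
  Submodule.Quotient.mk_eq_zero (nullFamilies 𝒰 E)

theorem mk_eq_mk_iff {x y : lp E ∞} :
    mk 𝒰 E x = mk 𝒰 E y ↔ Tendsto (fun j => ‖x j - y j‖) 𝒰 (𝓝 0) := by
  rw [← sub_eq_zero, ← map_sub, mk_eq_zero_iff]
  rfl

theorem mk_congr {x y : lp E ∞} (h : ∀ᶠ j in 𝒰, x j = y j) : mk 𝒰 E x = mk 𝒰 E y := by
  rw [mk_eq_mk_iff]
  refine tendsto_const_nhds.congr' ?_
  filter_upwards [h] with j hj
  simp [hj]

/-- Zeroing the coordinates of norm greater than c leaves the class unchanged and brings the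
supremum norm down to c. -/
theorem norm_mk_le_of_eventually {x : lp E ∞} {c : ℝ} (h : ∀ᶠ j in 𝒰, ‖x j‖ ≤ c) :
    ‖mk 𝒰 E x‖ ≤ c := by
  classical
  obtain ⟨j₀, hj₀⟩ := h.exists
  have hc : 0 ≤ c := (norm_nonneg _).trans hj₀
  set y : lp E ∞ := boundedFamily (fun j => if ‖x j‖ ≤ c then x j else 0) c (fun j => by
    split_ifs with hj
    · exact hj
    · simpa using hc)
  have hxy : mk 𝒰 E x = mk 𝒰 E y := mk_congr 𝒰 (by
    filter_upwards [h] with j hj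
    simp [y, hj])
  rw [hxy]
  refine (norm_mk_le 𝒰 y).trans (lp.norm_le_of_forall_le hc fun j => ?_)
  simp only [y, boundedFamily_apply]
  split_ifs with hj
  · exact hj
  · simpa using hc

/-- The quotient norm is an infimum over representatives, and a representative y satisfies ‖x j‖ ≤
‖x j − y j‖ + ‖y‖ with the first term tending to 0. -/
theorem le_norm_mk_of_eventually {x : lp E ∞} {c : ℝ} (h : ∀ᶠ j in 𝒰, c ≤ ‖x j‖) :
    c ≤ ‖mk 𝒰 E x‖ := by
  refine le_of_forall_pos_le_add fun ε hε => ?_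
  have : ‖mk 𝒰 E x‖ < ‖mk 𝒰 E x‖ + ε := by linarith
  obtain ⟨y, hy, hlt⟩ := (QuotientAddGroup.norm_lt_iff
    (S := (nullFamilies 𝒰 E).toAddSubgroup) (x := (mk 𝒰 E x : lp E ∞ ⧸ nullFamilies 𝒰 E))).1 this
  have hxy : mk 𝒰 E x = mk 𝒰 E y := hy.symm
  rw [mk_eq_mk_iff] at hxy
  have h2 : Tendsto (fun j => ‖x j - y j‖ + ‖y‖) 𝒰 (𝓝 (0 + ‖y‖)) := hxy.add_const _
  rw [zero_add] at h2
  refine (ge_of_tendsto h2 ?_).trans hlt.le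
  filter_upwards [h] with j hj
  have h3 : ‖y j‖ ≤ ‖y‖ := lp.norm_apply_le_norm ENNReal.top_ne_zero _ j
  have h4 := norm_le_norm_sub_add (x j) (y j)
  linarith

/-- Through this formula coordinatewise norm inequalities pass to the ultraproduct. An ultrafilter
decides every inequality, so a failed bound yields the opposite one on a large set. -/
theorem tendsto_norm_mk (x : lp E ∞) : Tendsto (fun j => ‖x j‖) 𝒰 (𝓝 ‖mk 𝒰 E x‖) := by
  rw [tendsto_order]
  constructor
  · intro c hc
    by_contra h
    rw [← Ultrafilter.eventually_not] at h
    exact absurd (norm_mk_le_of_eventually 𝒰 (h.mono fun j hj => not_lt.1 hj)) (not_le.2 hc)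
  · intro c hc
    by_contra h
    rw [← Ultrafilter.eventually_not] at h
    exact absurd (le_norm_mk_of_eventually 𝒰 (h.mono fun j hj => not_lt.1 hj)) (not_le.2 hc)

theorem norm_mk_le_norm_mk {F : I → Type*} [∀ j, NormedAddCommGroup (F j)]
    [∀ j, NormedSpace ℂ (F j)] {x : lp E ∞} {y : lp F ∞} (h : ∀ j, ‖x j‖ ≤ ‖y j‖) :
    ‖mk 𝒰 E x‖ ≤ ‖mk 𝒰 F y‖ :=
  le_of_tendsto_of_tendsto' (tendsto_norm_mk 𝒰 x) (tendsto_norm_mk 𝒰 y) h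

end Norm

section Map

variable {I : Type*} (𝒰 : Ultrafilter I) {E : I → Type*}
  [∀ j, NormedAddCommGroup (E j)] [∀ j, NormedSpace ℂ (E j)]

/-- The coordinatewise action of a family of linear isometries on bounded families. -/
noncomputable def lpMap (T : ∀ j, E j →ₗᵢ[ℂ] E j) : lp E ∞ →ₗ[ℂ] lp E ∞ where
  toFun x := boundedFamily (fun j => T j (x j)) ‖x‖ fun j => by
    rw [(T j).norm_map]; exact lp.norm_apply_le_norm ENNReal.top_ne_zero _ j
  map_add' x y := by ext j; simp
  map_smul' c x := by ext j; simp

@[simp]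
theorem lpMap_apply (T : ∀ j, E j →ₗᵢ[ℂ] E j) (x : lp E ∞) (j : I) :
    lpMap T x j = T j (x j) := rfl

/-- The linear isometry of an ultraproduct induced by a family of linear isometries. -/
noncomputable def map (T : ∀ j, E j →ₗᵢ[ℂ] E j) : Ultraproduct 𝒰 E →ₗᵢ[ℂ] Ultraproduct 𝒰 E where
  toLinearMap := (nullFamilies 𝒰 E).mapQ (nullFamilies 𝒰 E) (lpMap T) fun x hx => by
    change Tendsto (fun j => ‖T j (x j)‖) 𝒰 (𝓝 0)
    simp only [LinearIsometry.norm_map]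
    exact hx
  norm_map' z := by
    obtain ⟨x, rfl⟩ := mk_surjective 𝒰 z
    change ‖mk 𝒰 E (lpMap T x)‖ = _
    refine tendsto_nhds_unique (tendsto_norm_mk 𝒰 (lpMap T x)) ?_
    simpa using tendsto_norm_mk 𝒰 x

variable {X : Type*} [NormedAddCommGroup X] [NormedSpace ℂ X]

/-- The operator into an ultraproduct induced by a uniformly bounded family of operators. -/
noncomputable def pi (A : ∀ j, X →L[ℂ] E j) (C : ℝ) (hA : ∀ j x, ‖A j x‖ ≤ C * ‖x‖) :
    X →L[ℂ] Ultraproduct 𝒰 E :=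
  LinearMap.mkContinuous
    { toFun x := mk 𝒰 E (boundedFamily (fun j => A j x) (C * ‖x‖) fun j => hA j x)
      map_add' x y := by rw [← map_add]; congr 1; ext j; simp
      map_smul' c x := by rw [RingHom.id_apply, ← map_smul]; congr 1; ext j; simp }
    C fun x => norm_mk_le_of_eventually 𝒰 (Eventually.of_forall fun j => hA j x)

theorem norm_pi_le (A : ∀ j, X →L[ℂ] E j) (C : ℝ) (hC : 0 ≤ C)
    (hA : ∀ j x, ‖A j x‖ ≤ C * ‖x‖) : ‖pi 𝒰 A C hA‖ ≤ C :=
  LinearMap.mkContinuous_norm_le _ hC _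

end Map

section WeakLimit

variable {I : Type*} (𝒰 : Ultrafilter I) {E : I → Type*}
  [∀ j, NormedAddCommGroup (E j)] [∀ j, NormedSpace ℂ (E j)]

theorem tendsto_limUnder_of_norm_le {c : I → ℂ} {C : ℝ} (h : ∀ j, ‖c j‖ ≤ C) :
    Tendsto c 𝒰 (𝓝 (limUnder 𝒰 c)) := by
  have hK : IsCompact (Metric.closedBall (0 : ℂ) C) := isCompact_closedBall 0 C
  obtain ⟨a, -, ha⟩ := hK.ultrafilter_le_nhds (𝒰.map c) (by
    rw [le_principal_iff]
    exact Eventually.of_forall (f := (𝒰 : Filter I)) fun j => by simpa using h j)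
  exact tendsto_nhds_limUnder ⟨a, ha⟩

variable {X : Type*} [NormedAddCommGroup X] [NormedSpace ℂ X]
  (B : ∀ j, E j →L[ℂ] X) (C : ℝ)

theorem tendsto_limUnder_apply (hB : ∀ j x, ‖B j x‖ ≤ C * ‖x‖) (ℓ : StrongDual ℂ X)
    (x : lp E ∞) :
    Tendsto (fun j => ℓ (B j (x j))) 𝒰 (𝓝 (limUnder 𝒰 fun j => ℓ (B j (x j)))) := by
  refine tendsto_limUnder_of_norm_le 𝒰 (C := ‖ℓ‖ * (|C| * ‖x‖)) fun j => ?_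
  refine (ℓ.le_opNorm _).trans ?_
  gcongr
  refine (hB j _).trans ?_
  gcongr
  · exact le_abs_self C
  · exact lp.norm_apply_le_norm ENNReal.top_ne_zero _ j

theorem norm_limUnder_apply_le (hB : ∀ j x, ‖B j x‖ ≤ C * ‖x‖) (ℓ : StrongDual ℂ X)
    (x : lp E ∞) :
    ‖limUnder 𝒰 fun j => ℓ (B j (x j))‖ ≤ C * ‖mk 𝒰 E x‖ * ‖ℓ‖ := by
  refine le_of_tendsto_of_tendsto' (tendsto_limUnder_apply 𝒰 B C hB ℓ x).norm
    (((tendsto_norm_mk 𝒰 x).const_mul C).mul_const ‖ℓ‖) fun j => ?_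
  rw [mul_comm]
  refine (ℓ.le_opNorm _).trans ?_
  gcongr
  exact hB j _

/-- The weak-star limit of a uniformly bounded family of operators, on bounded families. -/
noncomputable def lpWeakLimit (hB : ∀ j x, ‖B j x‖ ≤ C * ‖x‖) :
    lp E ∞ →ₗ[ℂ] StrongDual ℂ (StrongDual ℂ X) where
  toFun x := LinearMap.mkContinuous
    { toFun ℓ := limUnder 𝒰 fun j => ℓ (B j (x j))
      map_add' ℓ ℓ' := ((tendsto_limUnder_apply 𝒰 B C hB ℓ x).add
        (tendsto_limUnder_apply 𝒰 B C hB ℓ' x)).limUnder_eq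
      map_smul' c ℓ := ((tendsto_limUnder_apply 𝒰 B C hB ℓ x).const_mul c).limUnder_eq }
    (C * ‖mk 𝒰 E x‖) fun ℓ => norm_limUnder_apply_le 𝒰 B C hB ℓ x
  map_add' x y := by
    ext ℓ
    refine Tendsto.limUnder_eq (((tendsto_limUnder_apply 𝒰 B C hB ℓ x).add
      (tendsto_limUnder_apply 𝒰 B C hB ℓ y)).congr fun j => ?_)
    simp
  map_smul' c x := by
    ext ℓ
    refine Tendsto.limUnder_eq (((tendsto_limUnder_apply 𝒰 B C hB ℓ x).const_mul c).congr
      fun j => ?_)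
    simp

theorem lpWeakLimit_apply (hB : ∀ j x, ‖B j x‖ ≤ C * ‖x‖) (x : lp E ∞) (ℓ : StrongDual ℂ X) :
    lpWeakLimit 𝒰 B C hB x ℓ = limUnder 𝒰 fun j => ℓ (B j (x j)) := rfl

/-- The weak-star limit of a uniformly bounded family of operators, as an operator from the
ultraproduct into the bidual. -/
noncomputable def weakLimit (hC : 0 ≤ C) (hB : ∀ j x, ‖B j x‖ ≤ C * ‖x‖) :
    Ultraproduct 𝒰 E →L[ℂ] StrongDual ℂ (StrongDual ℂ X) :=
  LinearMap.mkContinuous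
    ((nullFamilies 𝒰 E).liftQ (lpWeakLimit 𝒰 B C hB) fun x hx => by
      have hx0 : mk 𝒰 E x = 0 := (mk_eq_zero_iff 𝒰).2 hx
      rw [LinearMap.mem_ker]
      ext ℓ
      have h := norm_limUnder_apply_le 𝒰 B C hB ℓ x
      rw [hx0, norm_zero, mul_zero, zero_mul] at h
      rw [lpWeakLimit_apply, norm_le_zero_iff.1 h]
      rfl)
    C fun z => by
      obtain ⟨x, rfl⟩ := mk_surjective 𝒰 z
      refine ContinuousLinearMap.opNorm_le_bound _ (by positivity) fun ℓ => ?_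
      exact norm_limUnder_apply_le 𝒰 B C hB ℓ x

theorem norm_weakLimit_le (hC : 0 ≤ C) (hB : ∀ j x, ‖B j x‖ ≤ C * ‖x‖) :
    ‖weakLimit 𝒰 B C hC hB‖ ≤ C :=
  LinearMap.mkContinuous_norm_le _ hC _

end WeakLimit

end Ultraproduct

end GroupDilation

/-! ### Complexifications and dense domination. -/

namespace GroupDilation

namespace OrderData

section Basic

variable {E : Type*} [NormedAddCommGroup E] [NormedSpace ℂ E] {D : OrderData E}

/-- Uniqueness of the decomposition and closedness of the real part follow from the norm
inequality. -/
theorem IsComplexification.of_max_norm_le (complete : CompleteSpace E) (zero_mem : (0 : E) ∈ D.re)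
    (add_mem : ∀ x ∈ D.re, ∀ y ∈ D.re, x + y ∈ D.re)
    (smul_mem : ∀ (r : ℝ), ∀ x ∈ D.re, (r : ℂ) • x ∈ D.re)
    (exists_decomp : ∀ z : E, ∃ x ∈ D.re, ∃ y ∈ D.re, z = x + Complex.I • y)
    (max_norm_le : ∀ x ∈ D.re, ∀ y ∈ D.re, max ‖x‖ ‖y‖ ≤ ‖x + Complex.I • y‖) :
    D.IsComplexification := by
  have sub_mem : ∀ x ∈ D.re, ∀ y ∈ D.re, x - y ∈ D.re := fun x hx y hy => by
    have := add_mem x hx _ (smul_mem (-1) y hy)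
    simpa [sub_eq_add_neg] using this
  refine ⟨complete, zero_mem, add_mem, smul_mem, ?_, exists_decomp, ?_, max_norm_le⟩
  · refine isClosed_of_closure_subset fun z hz => ?_
    obtain ⟨x, hx, y, hy, rfl⟩ := exists_decomp z
    -- The imaginary part of z is bounded by the distance from z to any real w, because z − w has
    -- the same imaginary part.
    have hy0 : ‖y‖ ≤ 0 := by
      refine le_of_forall_pos_le_add fun ε hε => ?_
      obtain ⟨w, hw, hd⟩ := Metric.mem_closure_iff.1 hz ε hε
      have h := max_norm_le (x - w) (sub_mem x hx w hw) y hy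
      rw [dist_eq_norm] at hd
      have h2 : x - w + Complex.I • y = x + Complex.I • y - w := by abel
      rw [h2] at h
      linarith [le_max_right ‖x - w‖ ‖y‖]
    rw [norm_le_zero_iff.1 hy0]
    simpa using hx
  · intro x hx y hy x' hx' y' hy' h
    have h1 := max_norm_le (x - x') (sub_mem x hx x' hx') (y - y') (sub_mem y hy y' hy')
    have h2 : x - x' + Complex.I • (y - y') = 0 := by
      rw [smul_sub, ← sub_eq_zero.2 h]; abel
    rw [h2, norm_zero, max_le_iff] at h1
    exact ⟨sub_eq_zero.1 (norm_le_zero_iff.1 h1.1), sub_eq_zero.1 (norm_le_zero_iff.1 h1.2)⟩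

theorem IsComplexification.sub_mem (h : D.IsComplexification) {x y : E} (hx : x ∈ D.re)
    (hy : y ∈ D.re) : x - y ∈ D.re := by
  have := h.add_mem x hx _ (h.smul_mem (-1) y hy)
  simpa [sub_eq_add_neg] using this

/-- The inequality for the maximum, applied to differences, makes the real and imaginary part maps
contractions. This is the form in which they can be composed with L^p functions. -/
theorem IsComplexification.exists_lipschitz (h : D.IsComplexification) :
    ∃ R S : E → E, LipschitzWith 1 R ∧ LipschitzWith 1 S ∧ R 0 = 0 ∧ S 0 = 0 ∧
      (∀ z, R z ∈ D.re) ∧ (∀ z, S z ∈ D.re) ∧ (∀ z, z = R z + Complex.I • S z) ∧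
      ∀ z ∈ D.re, R z = z := by
  choose R hR S hS hRS using h.exists_decomp
  have key : ∀ z w, max ‖R z - R w‖ ‖S z - S w‖ ≤ ‖z - w‖ := fun z w => by
    refine (h.max_norm_le _ (h.sub_mem (hR z) (hR w)) _ (h.sub_mem (hS z) (hS w))).trans_eq ?_
    conv_rhs => rw [hRS z, hRS w]
    rw [smul_sub]
    congr 1
    abel
  have hre : ∀ z ∈ D.re, R z = z ∧ S z = 0 := fun z hz =>
    h.decomp_unique _ (hR z) _ (hS z) z hz 0 h.zero_mem (by rw [← hRS z]; simp)
  refine ⟨R, S, ?_, ?_, (hre 0 h.zero_mem).1, (hre 0 h.zero_mem).2, hR, hS, hRS,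
    fun z hz => (hre z hz).1⟩
  · refine LipschitzWith.of_dist_le_mul fun z w => ?_
    rw [dist_eq_norm, dist_eq_norm, NNReal.coe_one, one_mul]
    exact (le_max_left _ _).trans (key z w)
  · refine LipschitzWith.of_dist_le_mul fun z w => ?_
    rw [dist_eq_norm, dist_eq_norm, NNReal.coe_one, one_mul]
    exact (le_max_right _ _).trans (key z w)

theorem IsOrderedBanach.sum_mem_cone (h : D.IsOrderedBanach) {ι : Type*} (s : Finset ι)
    {x : ι → E} (hx : ∀ i, x i ∈ D.cone) : ∑ i ∈ s, x i ∈ D.cone := by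
  classical
  induction s using Finset.induction_on with
  | empty => simpa using h.zero_mem_cone
  | insert i s hi ih => rw [Finset.sum_insert hi]; exact h.add_mem_cone _ (hx i) _ ih

theorem IsComplexification.sum_mem (h : D.IsComplexification) {ι : Type*} (s : Finset ι)
    {x : ι → E} (hx : ∀ i, x i ∈ D.re) : ∑ i ∈ s, x i ∈ D.re := by
  classical
  induction s using Finset.induction_on with
  | empty => simpa using h.zero_mem
  | insert i s hi ih => rw [Finset.sum_insert hi]; exact h.add_mem _ (hx i) _ ih

/-- The domination property of a Riesz norm extends from a dense subgroup of the real part. -/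
theorem IsOrderedBanach.exists_dominating_of_dense (h : D.IsOrderedBanach) (S : AddSubgroup E)
    (hdense : D.re ⊆ closure (S : Set E))
    (hdom : ∀ x ∈ S, ∀ ε : ℝ, 0 < ε →
      ∃ y ∈ D.re, D.Le (-y) x ∧ D.Le x y ∧ ‖y‖ ≤ (1 + ε) * ‖x‖)
    (x : E) (hx : x ∈ D.re) (ε : ℝ) (hε : 0 < ε) :
    ∃ y ∈ D.re, D.Le (-y) x ∧ D.Le x y ∧ ‖y‖ ≤ (1 + ε) * ‖x‖ := by
  rcases eq_or_ne x 0 with rfl | hx0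
  · exact hdom 0 S.zero_mem ε hε
  have := h.complete
  have hxpos : 0 < ‖x‖ := norm_pos_iff.2 hx0
  -- For δ ≤ 1 the product is at most 1 + 5δ, hence the choice ε / 5.
  obtain ⟨δ, hδ, hδε⟩ : ∃ δ : ℝ, 0 < δ ∧ (1 + δ) * (1 + 2 * δ) ≤ 1 + ε := by
    refine ⟨min 1 (ε / 5), by positivity, ?_⟩
    have h1 : min 1 (ε / 5) ≤ 1 := min_le_left _ _
    have h2 : min 1 (ε / 5) ≤ ε / 5 := min_le_right _ _
    have h3 : 0 < min 1 (ε / 5) := by positivity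
    nlinarith
  set b : ℕ → ℝ := fun n => δ * ‖x‖ * (1 / 2) ^ (n + 1) with hb
  have hbpos : ∀ n, 0 < b n := fun n => by positivity
  -- Expand x as a series in S whose norms sum to at most ‖x‖ + δ‖x‖, dominate each term, and sum
  -- the dominating elements. The positivity of `b` is why x = 0 was treated apart.
  obtain ⟨v, hv, hvS, hv0, hvn⟩ := controlled_sum_of_mem_closure (hdense hx) hbpos
  choose y hy hy1 hy2 hyn using fun n => hdom (v n) (hvS n) δ hδ
  have hbsum : HasSum b (δ * ‖x‖) := by
    have h1 : HasSum (fun n : ℕ => δ * ‖x‖ * (1 / 2 : ℝ) * (1 / 2) ^ n)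
        (δ * ‖x‖ * (1 / 2 : ℝ) * 2) := hasSum_geometric_two.mul_left _
    convert h1 using 1
    · ext n; simp only [hb, pow_succ]; ring
    · ring
  have hvb : ∀ n, ‖v n‖ ≤ (if n = 0 then ‖x‖ else 0) + b n := fun n => by
    rcases Nat.eq_zero_or_pos n with rfl | hn
    · simp only [if_true]
      have h1 := norm_le_norm_add_norm_sub' (v 0) x
      rw [neg_add_eq_sub, norm_sub_rev] at hv0
      linarith
    · rw [if_neg hn.ne', zero_add]; exact (hvn n hn).le
  have hcsum : HasSum (fun n => (1 + δ) * ((if n = 0 then ‖x‖ else 0) + b n))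
      ((1 + δ) * (‖x‖ + δ * ‖x‖)) := ((hasSum_ite_eq 0 ‖x‖).add hbsum).mul_left _
  have hyb : ∀ n, ‖y n‖ ≤ (1 + δ) * ((if n = 0 then ‖x‖ else 0) + b n) := fun n =>
    (hyn n).trans (mul_le_mul_of_nonneg_left (hvb n) (by linarith))
  have hysum : Summable y := Summable.of_norm_bounded hcsum.summable hyb
  have hlim : Tendsto (fun n => ∑ k ∈ Finset.range (n + 1), y k) atTop (𝓝 (∑' n, y n)) :=
    hysum.hasSum.tendsto_sum_nat.comp (tendsto_add_atTop_nat 1)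
  refine ⟨∑' n, y n, ?_, ?_, ?_, ?_⟩
  · exact h.isClosed.mem_of_tendsto hlim (Eventually.of_forall fun n => h.sum_mem _ hy)
  · refine h.isClosed_cone.mem_of_tendsto (hv.sub hlim.neg) (Eventually.of_forall fun n => ?_)
    rw [sub_neg_eq_add, ← Finset.sum_add_distrib]
    exact h.sum_mem_cone _ fun k => by simpa [Le] using hy1 k
  · refine h.isClosed_cone.mem_of_tendsto (hlim.sub hv) (Eventually.of_forall fun n => ?_)
    rw [← Finset.sum_sub_distrib]
    exact h.sum_mem_cone _ hy2
  · refine (tsum_of_norm_bounded hcsum hyb).trans ?_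
    calc (1 + δ) * (‖x‖ + δ * ‖x‖)
      _ ≤ ((1 + δ) * (1 + 2 * δ)) * ‖x‖ := by nlinarith [mul_pos hδ hxpos]
      _ ≤ _ := by gcongr

end Basic

/-! ### Order structure of ultraproducts. -/

section Ultraproduct

variable {I : Type*} (𝒰 : Ultrafilter I) {E : I → Type*}
  [∀ j, NormedAddCommGroup (E j)] [∀ j, NormedSpace ℂ (E j)]

/-- Replace each coordinate of a representative by an almost nearest point of `S j`; membership of 0
keeps the new family bounded. Any approximant in the image bounds the distances to `S j` along 𝒰, so
the class does not change. -/
theorem isClosed_mk_image (S : ∀ j, Set (E j)) (hS : ∀ j, IsClosed (S j)) (h0 : ∀ j, 0 ∈ S j) :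
    IsClosed {z | ∃ x : lp E ∞, (∀ j, x j ∈ S j) ∧ Ultraproduct.mk 𝒰 E x = z} := by
  refine isClosed_of_closure_subset fun z hz => ?_
  obtain ⟨w, rfl⟩ := Ultraproduct.mk_surjective 𝒰 z
  -- A nearest point need not exist; the factor 2 leaves room when the distance is positive, and
  -- closedness settles distance zero.
  have hc : ∀ j, ∃ c ∈ S j, ‖w j - c‖ ≤ 2 * Metric.infDist (w j) (S j) := fun j => by
    rcases (Metric.infDist_nonneg (x := w j) (s := S j)).eq_or_lt with h | h
    · exact ⟨w j, ((hS j).mem_iff_infDist_zero ⟨0, h0 j⟩).2 h.symm, by simp [← h]⟩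
    · obtain ⟨c, hc, hd⟩ := (Metric.infDist_lt_iff ⟨0, h0 j⟩).1
        (show Metric.infDist (w j) (S j) < 2 * Metric.infDist (w j) (S j) by linarith)
      exact ⟨c, hc, by rw [← dist_eq_norm]; exact hd.le⟩
  choose c hcS hc using hc
  have hcw : ∀ j, ‖c j‖ ≤ 3 * ‖w‖ := fun j => by
    have h1 : Metric.infDist (w j) (S j) ≤ ‖w j‖ := by
      simpa using Metric.infDist_le_dist_of_mem (x := w j) (h0 j)
    have h2 : ‖w j‖ ≤ ‖w‖ := lp.norm_apply_le_norm ENNReal.top_ne_zero _ j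
    have h3 := norm_le_norm_add_norm_sub (w j) (c j)
    linarith [hc j]
  refine ⟨boundedFamily c (3 * ‖w‖) hcw, hcS, Eq.symm ((Ultraproduct.mk_eq_mk_iff 𝒰).2 ?_)⟩
  rw [Metric.tendsto_nhds]
  intro ε hε
  obtain ⟨_, ⟨c', hc', rfl⟩, hd⟩ := Metric.mem_closure_iff.1 hz (ε / 2) (half_pos hε)
  rw [dist_eq_norm, ← map_sub] at hd
  filter_upwards [(Ultraproduct.tendsto_norm_mk 𝒰 (w - c')).eventually_lt_const hd] with j hj
  have h1 : Metric.infDist (w j) (S j) ≤ ‖w j - c' j‖ := by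
    rw [← dist_eq_norm]; exact Metric.infDist_le_dist_of_mem (hc' j)
  have h2 : ‖(w - c') j‖ = ‖w j - c' j‖ := rfl
  rw [Real.dist_eq, sub_zero, abs_of_nonneg (norm_nonneg _), boundedFamily_apply]
  linarith [hc j]

variable {D : ∀ j, OrderData (E j)}

theorem IsComplexification.ultraproduct (h : ∀ j, (D j).IsComplexification) :
    (ultraproduct 𝒰 D).IsComplexification := by
  have := fun j => (h j).complete
  refine IsComplexification.of_max_norm_le inferInstance ⟨0, fun j => (h j).zero_mem, map_zero _⟩
    ?_ ?_ ?_ ?_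
  · rintro _ ⟨x, hx, rfl⟩ _ ⟨y, hy, rfl⟩
    exact ⟨x + y, fun j => (h j).add_mem _ (hx j) _ (hy j), map_add _ _ _⟩
  · rintro r _ ⟨x, hx, rfl⟩
    exact ⟨(r : ℂ) • x, fun j => (h j).smul_mem r _ (hx j), map_smul _ _ _⟩
  · intro z
    obtain ⟨w, rfl⟩ := Ultraproduct.mk_surjective 𝒰 z
    choose x hx y hy hxy using fun j => (h j).exists_decomp (w j)
    have hb : ∀ j, max ‖x j‖ ‖y j‖ ≤ ‖w‖ := fun j => by
      refine ((h j).max_norm_le _ (hx j) _ (hy j)).trans ?_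
      rw [← hxy j]
      exact lp.norm_apply_le_norm ENNReal.top_ne_zero _ j
    refine ⟨_, ⟨boundedFamily x ‖w‖ fun j => (le_max_left _ _).trans (hb j), hx, rfl⟩,
      _, ⟨boundedFamily y ‖w‖ fun j => (le_max_right _ _).trans (hb j), hy, rfl⟩, ?_⟩
    rw [← map_smul, ← map_add]
    congr 1
    ext j
    exact hxy j
  · rintro _ ⟨x, hx, rfl⟩ _ ⟨y, hy, rfl⟩
    rw [← map_smul, ← map_add]
    have hm := fun j => (h j).max_norm_le _ (hx j) _ (hy j)
    exact max_le (Ultraproduct.norm_mk_le_norm_mk 𝒰 fun j => (le_max_left _ _).trans (hm j))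
      (Ultraproduct.norm_mk_le_norm_mk 𝒰 fun j => (le_max_right _ _).trans (hm j))

/-- Here −(x + y) ≤ x − y ≤ x + y. Absolute monotonicity is thus phrased with cone elements only,
which lift to representatives of classes. -/
theorem IsRieszNormed.norm_le_of_add_mem_cone {E : Type*} [NormedAddCommGroup E] [NormedSpace ℂ E]
    {D : OrderData E} (h : D.IsRieszNormed) {x y : E} (hx : x ∈ D.cone) (hy : y ∈ D.cone) :
    ‖x - y‖ ≤ ‖x + y‖ := by
  refine h.absolutely_monotone _ (h.sub_mem (h.cone_subset hx) (h.cone_subset hy)) _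
    (h.add_mem _ (h.cone_subset hx) _ (h.cone_subset hy)) ?_ ?_
  · change x - y - -(x + y) ∈ D.cone
    have : x - y - -(x + y) = x + x := by abel
    rw [this]
    exact h.add_mem_cone _ hx _ hx
  · change x + y - (x - y) ∈ D.cone
    have : x + y - (x - y) = y + y := by abel
    rw [this]
    exact h.add_mem_cone _ hy _ hy

theorem IsRieszNormed.norm_le_norm_add {E : Type*} [NormedAddCommGroup E] [NormedSpace ℂ E]
    {D : OrderData E} (h : D.IsRieszNormed) {x y : E} (hx : x ∈ D.cone) (hy : y ∈ D.cone) :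
    ‖x‖ ≤ ‖x + y‖ := by
  refine h.absolutely_monotone _ (h.cone_subset hx) _
    (h.add_mem _ (h.cone_subset hx) _ (h.cone_subset hy)) ?_ ?_
  · change x - -(x + y) ∈ D.cone
    rw [sub_neg_eq_add]
    exact h.add_mem_cone _ hx _ (h.add_mem_cone _ hx _ hy)
  · change x + y - x ∈ D.cone
    rwa [add_sub_cancel_left]

theorem IsRieszNormed.ultraproduct (h : ∀ j, (D j).IsRieszNormed) :
    (ultraproduct 𝒰 D).IsRieszNormed := by
  have hC := IsComplexification.ultraproduct 𝒰 fun j => (h j).toIsComplexification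
  have hO : (OrderData.ultraproduct 𝒰 D).IsOrderedBanach := by
    refine ⟨hC, ?_, ⟨0, fun j => (h j).zero_mem_cone, map_zero _⟩, ?_, ?_,
      isClosed_mk_image 𝒰 _ (fun j => (h j).isClosed_cone) fun j => (h j).zero_mem_cone, ?_⟩
    · rintro _ ⟨x, hx, rfl⟩
      exact ⟨x, fun j => (h j).cone_subset (hx j), rfl⟩
    · rintro _ ⟨x, hx, rfl⟩ _ ⟨y, hy, rfl⟩
      exact ⟨x + y, fun j => (h j).add_mem_cone _ (hx j) _ (hy j), map_add _ _ _⟩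
    · rintro r hr _ ⟨x, hx, rfl⟩
      exact ⟨(r : ℂ) • x, fun j => (h j).smul_mem_cone r hr _ (hx j), map_smul _ _ _⟩
    · rintro _ ⟨x, hx, rfl⟩ ⟨y, hy, hxy⟩
      -- The positive families x and y represent opposite classes; their sum is null and dominates x
      -- in norm.
      have h0 : Ultraproduct.mk 𝒰 E (x + y) = 0 := by rw [map_add, hxy, add_neg_cancel]
      rw [← norm_le_zero_iff, ← norm_zero (E := Ultraproduct 𝒰 E), ← h0]
      exact Ultraproduct.norm_mk_le_norm_mk 𝒰 fun j => (h j).norm_le_norm_add (hx j) (hy j)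
  refine ⟨hO, ?_, ?_⟩
  · rintro x - y - ⟨u, hu, hu'⟩ ⟨w, hw, hw'⟩
    -- The positive families u and w represent x + y and y − x, so half their difference and half
    -- their sum are compatible representatives of x and y.
    have hx : x = (((1 / 2 : ℝ) : ℂ)) • Ultraproduct.mk 𝒰 E (u - w) := by
      rw [map_sub, hu', hw']
      have : x - -y - (y - x) = (2 : ℂ) • x := by rw [two_smul]; abel
      rw [this, smul_smul]
      norm_num
    have hy : y = (((1 / 2 : ℝ) : ℂ)) • Ultraproduct.mk 𝒰 E (u + w) := by
      rw [map_add, hu', hw']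
      have : x - -y + (y - x) = (2 : ℂ) • y := by rw [two_smul]; abel
      rw [this, smul_smul]
      norm_num
    rw [hx, hy, norm_smul, norm_smul]
    gcongr
    exact Ultraproduct.norm_mk_le_norm_mk 𝒰 fun j => (h j).norm_le_of_add_mem_cone (hu j) (hw j)
  · rintro _ ⟨x, hx, rfl⟩ ε hε
    choose y hy hy1 hy2 hyn using fun j => (h j).exists_dominating (x j) (hx j) ε hε
    have hb : ∀ j, ‖y j‖ ≤ (1 + ε) * ‖x‖ := fun j => (hyn j).trans <| by
      gcongr
      exact lp.norm_apply_le_norm ENNReal.top_ne_zero _ j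
    set Y := boundedFamily y _ hb with hY
    refine ⟨Ultraproduct.mk 𝒰 E Y, ⟨Y, hy, rfl⟩, ⟨x - -Y, hy1, ?_⟩, ⟨Y - x, hy2, ?_⟩, ?_⟩
    · rw [map_sub, map_neg]
    · rw [map_sub]
    · exact le_of_tendsto_of_tendsto' (Ultraproduct.tendsto_norm_mk 𝒰 Y)
        ((Ultraproduct.tendsto_norm_mk 𝒰 x).const_mul _) hyn

end Ultraproduct

/-! ### Order structure of Bochner spaces. -/

section Bochner

variable {E : Type*} [NormedAddCommGroup E] {D : OrderData E}
  {Ω : Type*} [MeasurableSpace Ω] {p : ℝ≥0∞} {μ : Measure Ω}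

/-- An L^p-convergent sequence has a subsequence converging almost everywhere, to which pointwise
closedness applies. -/
theorem isClosed_ae_mem [Fact (1 ≤ p)] {S : Set E} (hS : IsClosed S) :
    IsClosed {f : Lp E p μ | ∀ᵐ t ∂μ, f t ∈ S} := by
  rw [← isSeqClosed_iff_isClosed]
  intro f g hf hfg
  obtain ⟨φ, -, hφ⟩ := (tendstoInMeasure_of_tendsto_Lp hfg).exists_seq_tendsto_ae
  filter_upwards [ae_all_iff.2 hf, hφ] with t ht hφt
  exact hS.mem_of_tendsto hφt (Eventually.of_forall fun n => ht _)

theorem mem_bochner_re {f : Lp E p μ} : f ∈ (D.bochner p μ).re ↔ ∀ᵐ t ∂μ, f t ∈ D.re := Iff.rfl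

theorem mem_bochner_cone {f : Lp E p μ} :
    f ∈ (D.bochner p μ).cone ↔ ∀ᵐ t ∂μ, f t ∈ D.cone := Iff.rfl

theorem bochner_le_iff [NormedSpace ℂ E] [Fact (1 ≤ p)] {f g : Lp E p μ} :
    (D.bochner p μ).Le f g ↔ ∀ᵐ t ∂μ, D.Le (f t) (g t) := by
  unfold Le
  rw [mem_bochner_cone]
  refine eventually_congr ?_
  filter_upwards [Lp.coeFn_sub g f] with t ht
  rw [ht, Pi.sub_apply]

variable [NormedSpace ℂ E] [Fact (1 ≤ p)]

theorem IsComplexification.bochner (h : D.IsComplexification) :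
    (D.bochner p μ).IsComplexification := by
  have := h.complete
  obtain ⟨R, S, hR, hS, hR0, hS0, hRre, hSre, hRS, -⟩ := h.exists_lipschitz
  refine IsComplexification.of_max_norm_le inferInstance ?_ ?_ ?_ ?_ ?_
  · filter_upwards [Lp.coeFn_zero E p μ] with t ht
    rw [ht]
    exact h.zero_mem
  · intro f hf g hg
    rw [mem_bochner_re] at hf hg ⊢
    filter_upwards [Lp.coeFn_add f g, hf, hg] with t ht hft hgt
    rw [ht]
    exact h.add_mem _ hft _ hgt
  · intro r f hf
    rw [mem_bochner_re] at hf ⊢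
    filter_upwards [Lp.coeFn_smul (r : ℂ) f, hf] with t ht hft
    rw [ht]
    exact h.smul_mem r _ hft
  · intro f
    refine ⟨hR.compLp hR0 f, ?_, hS.compLp hS0 f, ?_, ?_⟩
    · filter_upwards [hR.coeFn_compLp hR0 f] with t ht
      rw [ht]
      exact hRre _
    · filter_upwards [hS.coeFn_compLp hS0 f] with t ht
      rw [ht]
      exact hSre _
    · ext1
      filter_upwards [hR.coeFn_compLp hR0 f, hS.coeFn_compLp hS0 f,
        Lp.coeFn_add (hR.compLp hR0 f) (Complex.I • hS.compLp hS0 f),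
        Lp.coeFn_smul Complex.I (hS.compLp hS0 f)] with t h1 h2 h3 h4
      rw [h3, Pi.add_apply, h4, Pi.smul_apply, h1, h2]
      exact hRS _
  · intro f hf g hg
    rw [mem_bochner_re] at hf hg
    have hae : ∀ᵐ t ∂μ, max ‖f t‖ ‖g t‖ ≤ ‖(f + Complex.I • g) t‖ := by
      filter_upwards [hf, hg, Lp.coeFn_add f (Complex.I • g), Lp.coeFn_smul Complex.I g]
        with t h1 h2 h3 h4
      rw [h3, Pi.add_apply, h4, Pi.smul_apply]
      exact h.max_norm_le _ h1 _ h2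
    exact max_le (Lp.norm_le_norm_of_ae_le (hae.mono fun t ht => (le_max_left _ _).trans ht))
      (Lp.norm_le_norm_of_ae_le (hae.mono fun t ht => (le_max_right _ _).trans ht))

theorem IsOrderedBanach.bochner (h : D.IsOrderedBanach) :
    (D.bochner p μ).IsOrderedBanach := by
  refine ⟨h.toIsComplexification.bochner, ?_, ?_, ?_, ?_, isClosed_ae_mem h.isClosed_cone, ?_⟩
  · intro f hf
    rw [mem_bochner_cone] at hf
    exact hf.mono fun t ht => h.cone_subset ht
  · filter_upwards [Lp.coeFn_zero E p μ] with t ht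
    rw [ht]
    exact h.zero_mem_cone
  · intro f hf g hg
    rw [mem_bochner_cone] at hf hg ⊢
    filter_upwards [Lp.coeFn_add f g, hf, hg] with t ht hft hgt
    rw [ht]
    exact h.add_mem_cone _ hft _ hgt
  · intro r hr f hf
    rw [mem_bochner_cone] at hf ⊢
    filter_upwards [Lp.coeFn_smul (r : ℂ) f, hf] with t ht hft
    rw [ht]
    exact h.smul_mem_cone r hr _ hft
  · intro f hf hf'
    rw [mem_bochner_cone] at hf hf'
    rw [Lp.eq_zero_iff_ae_eq_zero]
    filter_upwards [Lp.coeFn_neg f, hf, hf'] with t ht hft hft'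
    rw [ht] at hft'
    exact h.cone_proper _ hft hft'

/-- The real simple functions in `L^p`. -/
def realSimpleFunc (h : D.IsComplexification) (p : ℝ≥0∞) [Fact (1 ≤ p)] (μ : Measure Ω) :
    AddSubgroup (Lp E p μ) where
  carrier := {f | f ∈ Lp.simpleFunc E p μ ∧ f ∈ (D.bochner p μ).re}
  zero_mem' := ⟨zero_mem _, h.bochner.zero_mem⟩
  add_mem' hf hg := ⟨add_mem hf.1 hg.1, h.bochner.add_mem _ hf.2 _ hg.2⟩
  neg_mem' {f} hf := ⟨neg_mem hf.1, by
    rw [← zero_sub]; exact h.bochner.sub_mem h.bochner.zero_mem hf.2⟩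

/-- Composition with the real part map is continuous on L^p, fixes real functions and keeps simple
functions simple, so it turns simple approximants into real ones. -/
theorem re_subset_closure_realSimpleFunc (h : D.IsComplexification) (hp : p ≠ ∞) :
    (D.bochner p μ).re ⊆ closure (realSimpleFunc h p μ : Set (Lp E p μ)) := by
  intro f hf
  obtain ⟨R, -, hR, -, hR0, -, hRre, -, -, hRid⟩ := h.exists_lipschitz
  have hRf : hR.compLp hR0 f = f := by
    ext1
    filter_upwards [hR.coeFn_compLp hR0 f, hf] with t ht hft
    rw [ht]
    exact hRid _ hft
  rw [← hRf]
  refine map_mem_closure (hR.continuous_compLp hR0) (Lp.simpleFunc.dense (μ := μ) hp f) ?_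
  intro g hg
  refine ⟨?_, ?_⟩
  · obtain ⟨s, hs⟩ := hg
    refine ⟨s.map R, ?_⟩
    have hgs : g =ᵐ[μ] s := by
      rw [← hs]
      exact AEEqFun.coeFn_mk _ _
    refine (AEEqFun.mk_eq_mk.2 ?_).trans (AEEqFun.mk_coeFn _)
    filter_upwards [hR.coeFn_compLp hR0 g, hgs] with t h1 h2
    rw [h1, Function.comp_apply, h2]
    rfl
  · filter_upwards [hR.coeFn_compLp hR0 g] with t ht
    rw [ht]
    exact hRre _

theorem IsRieszNormed.bochner (h : D.IsRieszNormed) (hp : p ≠ ∞) :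
    (D.bochner p μ).IsRieszNormed := by
  have hO : (D.bochner p μ).IsOrderedBanach := h.toIsOrderedBanach.bochner
  refine ⟨hO, ?_, ?_⟩
  · intro f hf g hg h1 h2
    rw [bochner_le_iff] at h1 h2
    refine Lp.norm_le_norm_of_ae_le ?_
    filter_upwards [hf, hg, h1, h2, Lp.coeFn_neg g] with t hf hg h1 h2 h3
    rw [h3] at h1
    exact h.absolutely_monotone _ hf _ hg h1 h2
  -- Dominating elements are chosen without any measurability in x. On simple functions this is
  -- harmless, and density handles the rest.
  · refine hO.exists_dominating_of_dense (realSimpleFunc h.toIsComplexification p μ)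
      (re_subset_closure_realSimpleFunc _ hp) ?_
    rintro f ⟨⟨s, hs⟩, hf⟩ ε hε
    classical
    -- The simple function may take non-real values on a null set; the default 0 there keeps the
    -- norm bound valid for every x.
    have hdom : ∀ x : E, ∃ y ∈ D.re, ‖y‖ ≤ (1 + ε) * ‖x‖ ∧
        (x ∈ D.re → D.Le (-y) x ∧ D.Le x y) := fun x => by
      by_cases hx : x ∈ D.re
      · obtain ⟨y, hy, h1, h2, h3⟩ := h.exists_dominating x hx ε hε
        exact ⟨y, hy, h3, fun _ => ⟨h1, h2⟩⟩
      · exact ⟨0, h.zero_mem, by rw [norm_zero]; positivity, fun hx' => absurd hx' hx⟩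
    choose Y hYre hYn hY using hdom
    have hfs : f =ᵐ[μ] s := by
      rw [← hs]
      exact AEEqFun.coeFn_mk _ _
    have hmem : MemLp (s.map Y) p μ := by
      refine MemLp.of_le_mul (c := 1 + ε) (Lp.memLp f) (s.map Y).aestronglyMeasurable ?_
      filter_upwards [hfs] with t ht
      rw [ht]
      exact hYn _
    refine ⟨hmem.toLp _, ?_, ?_, ?_, ?_⟩
    · filter_upwards [hmem.coeFn_toLp] with t ht
      rw [ht]
      exact hYre _
    · rw [bochner_le_iff]
      filter_upwards [hmem.coeFn_toLp, Lp.coeFn_neg (hmem.toLp _), hfs, hf] with t h1 h2 h3 h4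
      rw [h2, Pi.neg_apply, h1]
      rw [h3] at h4 ⊢
      exact (hY _ h4).1
    · rw [bochner_le_iff]
      filter_upwards [hmem.coeFn_toLp, hfs, hf] with t h1 h3 h4
      rw [h1]
      rw [h3] at h4 ⊢
      exact (hY _ h4).2
    · refine Lp.norm_le_mul_norm_of_ae_le_mul ?_
      filter_upwards [hmem.coeFn_toLp, hfs] with t h1 h3
      rw [h1, h3]
      exact hYn _

end Bochner

end OrderData

end GroupDilation

/-! ### Probability densities, right translations and Reiter's property. -/

namespace GroupDilation

section Density

variable {G : Type*} [TopologicalSpace G] [MeasurableSpace G] (μ : Measure G)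

/-- `φ` is a continuous compactly supported probability density with respect to `μ`. -/
structure IsDensity (φ : G → ℝ) : Prop where
  continuous : Continuous φ
  hasCompactSupport : HasCompactSupport φ
  nonneg : ∀ s, 0 ≤ φ s
  integral_eq : ∫ s, φ s ∂μ = 1

variable {μ}

theorem IsDensity.integrable [BorelSpace G] [IsFiniteMeasureOnCompacts μ] {φ : G → ℝ}
    (h : IsDensity μ φ) : Integrable φ μ :=
  h.continuous.integrable_of_hasCompactSupport h.hasCompactSupport

variable (μ)

/-- The classes in `L^1(μ)` of the continuous compactly supported probability densities. -/
def densityClasses : Set (Lp ℝ 1 μ) := {f | ∃ φ, IsDensity μ φ ∧ f =ᵐ[μ] φ}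

theorem convex_densityClasses [BorelSpace G] [IsFiniteMeasureOnCompacts μ] :
    Convex ℝ (densityClasses μ) := by
  rintro f ⟨φ, hφ, hf⟩ g ⟨ψ, hψ, hg⟩ a b ha hb hab
  refine ⟨fun s => a * φ s + b * ψ s, ⟨?_, ?_, ?_, ?_⟩, ?_⟩
  · have := hφ.continuous
    have := hψ.continuous
    fun_prop
  · exact hφ.hasCompactSupport.mul_left.add hψ.hasCompactSupport.mul_left
  · intro s
    have := hφ.nonneg s
    have := hψ.nonneg s
    positivity
  · rw [integral_add (hφ.integrable.const_mul a) (hψ.integrable.const_mul b),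
      integral_const_mul, integral_const_mul, hφ.integral_eq, hψ.integral_eq, mul_one, mul_one, hab]
  · filter_upwards [hf, hg, Lp.coeFn_add (a • f) (b • g), Lp.coeFn_smul a f, Lp.coeFn_smul b g]
      with s h1 h2 h3 h4 h5
    rw [h3, Pi.add_apply, h4, h5, Pi.smul_apply, Pi.smul_apply, h1, h2, smul_eq_mul, smul_eq_mul]

end Density

section Reiter

variable {G : Type*} [Group G] [TopologicalSpace G] [IsTopologicalGroup G] [MeasurableSpace G]
  [BorelSpace G] (μ : Measure G)

/-- Right translation `f ↦ f (· * t)` on `L^p(μ; E)`. -/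
noncomputable def rightTranslate [μ.IsMulRightInvariant] (𝕜 : Type*) [NormedRing 𝕜]
    {E : Type*} [NormedAddCommGroup E] [Module 𝕜 E] [IsBoundedSMul 𝕜 E] (p : ℝ≥0∞)
    [Fact (1 ≤ p)] (t : G) : Lp E p μ →ₗᵢ[𝕜] Lp E p μ :=
  Lp.compMeasurePreservingₗᵢ 𝕜 (· * t) (measurePreserving_mul_right μ t)

section Apply

variable {𝕜 : Type*} [NormedRing 𝕜] {E : Type*} [NormedAddCommGroup E] [Module 𝕜 E]
  [IsBoundedSMul 𝕜 E] {p : ℝ≥0∞} [Fact (1 ≤ p)] [μ.IsMulRightInvariant]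

theorem coeFn_rightTranslate (t : G) (f : Lp E p μ) :
    rightTranslate μ 𝕜 p t f =ᵐ[μ] fun s => f (s * t) :=
  Lp.coeFn_compMeasurePreserving f (measurePreserving_mul_right μ t)

theorem coeFn_rightTranslate_of_ae_eq (t : G) {f : Lp E p μ} {φ : G → E} (h : f =ᵐ[μ] φ) :
    rightTranslate μ 𝕜 p t f =ᵐ[μ] fun s => φ (s * t) :=
  (coeFn_rightTranslate μ t f).trans
    ((measurePreserving_mul_right μ t).quasiMeasurePreserving.ae_eq_comp h)

theorem rightTranslate_mul (s t : G) (f : Lp E p μ) :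
    rightTranslate μ 𝕜 p (s * t) f = rightTranslate μ 𝕜 p s (rightTranslate μ 𝕜 p t f) := by
  ext1
  filter_upwards [coeFn_rightTranslate μ (𝕜 := 𝕜) (s * t) f,
    coeFn_rightTranslate_of_ae_eq μ (𝕜 := 𝕜) s (coeFn_rightTranslate μ (𝕜 := 𝕜) t f)] with x h1 h2
  rw [h1, h2, mul_assoc]

theorem rightTranslate_one (f : Lp E p μ) : rightTranslate μ 𝕜 p (1 : G) f = f := by
  ext1
  filter_upwards [coeFn_rightTranslate μ (𝕜 := 𝕜) (1 : G) f] with x h1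
  rw [h1, mul_one]

theorem continuous_rightTranslate [LocallyCompactSpace G] [μ.Regular] (hp : p ≠ ∞)
    (f : Lp E p μ) : Continuous fun t => rightTranslate μ 𝕜 p t f := by
  have hg : Continuous fun t : G => (⟨(· * t), continuous_mul_const t⟩ : C(G, G)) :=
    ContinuousMap.continuous_of_continuous_uncurry _
      (show Continuous fun x : G × G => x.2 * x.1 by fun_prop)
  exact (continuous_const (y := f)).compMeasurePreservingLp hg
    (fun t => measurePreserving_mul_right μ t) hp

end Apply

variable {μ}

theorem IsDensity.comp_mul_right [μ.IsMulRightInvariant] {φ : G → ℝ} (h : IsDensity μ φ) (t : G) :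
    IsDensity μ fun s => φ (s * t) where
  continuous := h.continuous.comp (continuous_mul_const t)
  hasCompactSupport := h.hasCompactSupport.comp_homeomorph (Homeomorph.mulRight t)
  nonneg s := h.nonneg _
  integral_eq := by rw [integral_mul_right_eq_self φ t, h.integral_eq]

variable (μ)

/-- Regularity provides a compact set of positive measure; normalize a compactly supported Urysohn
function equal to 1 on it. -/
theorem exists_isDensity [LocallyCompactSpace G] [T2Space G] [μ.Regular] [NeZero μ] :
    ∃ φ : G → ℝ, IsDensity μ φ := by
  have h0 : 0 < μ Set.univ := by
    rw [pos_iff_ne_zero, Ne, Measure.measure_univ_eq_zero]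
    exact NeZero.ne μ
  obtain ⟨K, -, hK, hμK⟩ := isOpen_univ.exists_lt_isCompact (μ := μ) h0
  obtain ⟨f, hfK, -, hfc, hf01⟩ := exists_continuous_one_zero_of_isCompact hK isClosed_empty
    (Set.disjoint_empty K)
  have hint : Integrable f μ := f.continuous.integrable_of_hasCompactSupport hfc
  have hpos : 0 < ∫ s, f s ∂μ := by
    rw [integral_pos_iff_support_of_nonneg (fun s => (hf01 s).1) hint]
    refine hμK.trans_le (measure_mono fun s hs => ?_)
    rw [Function.mem_support, hfK hs]
    exact one_ne_zero
  refine ⟨fun s => (∫ s, f s ∂μ)⁻¹ * f s, by fun_prop, hfc.mul_left, fun s => ?_, ?_⟩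
  · exact mul_nonneg (inv_nonneg.2 hpos.le) (hf01 s).1
  · rw [integral_const_mul, inv_mul_cancel₀ hpos.ne']

/-- Day's convexity argument: the differences between densities and their translates by a finite
set accumulate at `0`. -/
theorem zero_mem_closure_translate_sub [μ.IsMulRightInvariant]
    [LocallyCompactSpace G] [T2Space G] [μ.Regular] [NeZero μ]
    (hG : IsAmenable G) (F : Finset G) :
    (0 : F → Lp ℝ 1 μ) ∈
      closure ((fun f (t : F) => rightTranslate μ ℝ 1 (t : G) f - f) '' densityClasses μ) := by
  classical
  let Λ : Lp ℝ 1 μ →ₗ[ℝ] (F → Lp ℝ 1 μ) :=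
    LinearMap.pi fun t => (rightTranslate μ ℝ 1 (t : G)).toLinearMap - LinearMap.id
  change (0 : F → Lp ℝ 1 μ) ∈ closure (Λ '' densityClasses μ)
  by_contra hcon
  -- Separating 0 from the closed convex set gives a functional ξ with ξ(Λf) > u > 0 for every
  -- density f.
  obtain ⟨ξ, u, hu, hξ⟩ := geometric_hahn_banach_point_closed
    ((convex_densityClasses μ).linear_image Λ).closure isClosed_closure hcon
  rw [map_zero] at hu
  obtain ⟨φ, hφ⟩ := exists_isDensity μ
  have hφL : MemLp φ 1 μ := memLp_one_iff_integrable.2 hφ.integrable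
  set ψ : Lp ℝ 1 μ := hφL.toLp φ
  have hψ : ∀ s : G, rightTranslate μ ℝ 1 s ψ ∈ densityClasses μ := fun s =>
    ⟨_, hφ.comp_mul_right s, coeFn_rightTranslate_of_ae_eq μ s hφL.coeFn_toLp⟩
  -- Evaluating ξ along the translation orbit of one density gives bounded continuous functions;
  -- R_{ts} = R_t R_s turns left translation of h_t by t into the action of R_t on that orbit.
  let h : F → G →ᵇ ℝ := fun t => BoundedContinuousFunction.ofNormedAddCommGroup
    (fun s => ξ (Pi.single t (rightTranslate μ ℝ 1 s ψ)))
    (ξ.continuous.comp ((continuous_single t).comp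
      (continuous_rightTranslate μ ENNReal.one_ne_top ψ)))
    (‖ξ‖ * ‖ψ‖) fun s => by
      refine (ξ.le_opNorm _).trans_eq ?_
      rw [Pi.norm_single, LinearIsometry.norm_map]
  have hval : ∀ s, ∑ t : F, (leftTranslate (t : G) (h t) - h t) s =
      ξ (Λ (rightTranslate μ ℝ 1 s ψ)) := fun s => by
    rw [← Finset.univ_sum_single (Λ (rightTranslate μ ℝ 1 s ψ)), map_sum]
    refine Finset.sum_congr rfl fun t _ => ?_
    change ξ (Pi.single t (rightTranslate μ ℝ 1 ((t : G) * s) ψ)) -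
      ξ (Pi.single t (rightTranslate μ ℝ 1 s ψ)) = ξ (Pi.single t
        (rightTranslate μ ℝ 1 (t : G) (rightTranslate μ ℝ 1 s ψ) - rightTranslate μ ℝ 1 s ψ))
    rw [← map_sub, ← Pi.single_sub, rightTranslate_mul]
  obtain ⟨m, hm1, hmpos, hminv⟩ := hG
  -- The sum exceeds u everywhere, yet an invariant mean sends it to 0, which forces u ≤ 0.
  have key := hmpos (∑ t : F, (leftTranslate (t : G) (h t) - h t) -
    u • BoundedContinuousFunction.const G 1) fun s => by
      rw [BoundedContinuousFunction.sub_apply, BoundedContinuousFunction.sum_apply, hval]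
      have := hξ _ (subset_closure (Set.mem_image_of_mem Λ (hψ s)))
      simp only [BoundedContinuousFunction.coe_smul, BoundedContinuousFunction.const_apply,
        smul_eq_mul, mul_one]
      linarith
  rw [map_sub, map_sum, map_smul, hm1] at key
  simp only [map_sub, hminv, sub_self, Finset.sum_const_zero, smul_eq_mul, mul_one] at key
  linarith

/-- Reiter's property of an amenable group, for finite sets. -/
theorem exists_isDensity_integral_translate_sub_le [μ.IsMulRightInvariant]
    [LocallyCompactSpace G] [T2Space G] [μ.Regular]
    [NeZero μ] (hG : IsAmenable G) (F : Finset G) {ε : ℝ} (hε : 0 < ε) :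
    ∃ φ : G → ℝ, IsDensity μ φ ∧ ∀ t ∈ F, ∫ s, |φ (s * t) - φ s| ∂μ ≤ ε := by
  obtain ⟨_, ⟨f, ⟨φ, hφ, hf⟩, rfl⟩, hd⟩ :=
    Metric.mem_closure_iff.1 (zero_mem_closure_translate_sub μ hG F) ε hε
  refine ⟨φ, hφ, fun t ht => ?_⟩
  rw [dist_zero_left, pi_norm_lt_iff hε] at hd
  refine le_trans (le_of_eq ?_) (hd ⟨t, ht⟩).le
  rw [L1.norm_eq_integral_norm]
  refine integral_congr_ae ?_
  filter_upwards [hf, coeFn_rightTranslate_of_ae_eq μ (𝕜 := ℝ) t hf,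
    Lp.coeFn_sub (rightTranslate μ ℝ 1 t f) f] with s h1 h2 h3
  rw [h3, Pi.sub_apply, h2, h1, Real.norm_eq_abs]

end Reiter

end GroupDilation

/-! ### The maps between X and L^p attached to a density. -/

namespace GroupDilation

section Estimates

variable {Ω : Type*} [MeasurableSpace Ω] {μ : Measure Ω} {X : Type*} [NormedAddCommGroup X]
  {p : ℝ≥0∞}

theorem eLpNorm_abs_rpow_one_div (hp0 : p ≠ 0) (hp : p ≠ ∞) (g : Ω → ℝ) :
    eLpNorm (fun s => |g s| ^ (1 / p.toReal)) p μ =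
      (∫⁻ s, ENNReal.ofReal |g s| ∂μ) ^ (1 / p.toReal) := by
  rw [eLpNorm_eq_lintegral_rpow_enorm_toReal hp0 hp]
  congr 1
  refine lintegral_congr fun s => ?_
  have hr : p.toReal ≠ 0 := (ENNReal.toReal_pos hp0 hp).ne'
  rw [Real.enorm_of_nonneg (by positivity),
    ENNReal.ofReal_rpow_of_nonneg (by positivity) (by positivity),
    ← Real.rpow_mul (abs_nonneg _), one_div_mul_cancel hr, Real.rpow_one]

/-- Serves both the boundedness of the orbit map, with g the density, and its intertwining error,
with g a difference of densities. -/
theorem eLpNorm_le_of_ae_le_rpow (hp0 : p ≠ 0) (hp : p ≠ ∞) {f : Ω → X} {g : Ω → ℝ}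
    (hg : Integrable g μ) {C : ℝ} (h : ∀ᵐ s ∂μ, ‖f s‖ ≤ C * |g s| ^ (1 / p.toReal)) :
    eLpNorm f p μ ≤ ENNReal.ofReal C * ENNReal.ofReal ((∫ s, |g s| ∂μ) ^ (1 / p.toReal)) := by
  have h1 : ∀ᵐ s ∂μ, ‖f s‖ ≤ C * ‖|g s| ^ (1 / p.toReal)‖ := by
    filter_upwards [h] with s hs
    rwa [Real.norm_of_nonneg (by positivity)]
  refine (eLpNorm_le_mul_eLpNorm_of_ae_le_mul h1 p).trans_eq ?_
  rw [eLpNorm_abs_rpow_one_div hp0 hp, ← ENNReal.ofReal_rpow_of_nonneg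
    (integral_nonneg fun s => abs_nonneg _) (by positivity),
    ofReal_integral_eq_lintegral_ofReal hg.abs (ae_of_all _ fun s => abs_nonneg _)]

theorem norm_toLp_le_of_ae_le_rpow (hp0 : p ≠ 0) (hp : p ≠ ∞) {f : Lp X p μ} {g : Ω → ℝ}
    (hg : Integrable g μ) {C : ℝ} (hC : 0 ≤ C)
    (h : ∀ᵐ s ∂μ, ‖f s‖ ≤ C * |g s| ^ (1 / p.toReal)) :
    ‖f‖ ≤ C * (∫ s, |g s| ∂μ) ^ (1 / p.toReal) := by
  have hI : 0 ≤ ∫ s, |g s| ∂μ := integral_nonneg fun s => abs_nonneg _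
  rw [Lp.norm_def]
  refine ENNReal.toReal_le_of_le_ofReal (by positivity) ?_
  rw [ENNReal.ofReal_mul hC]
  exact eLpNorm_le_of_ae_le_rpow hp0 hp hg h

/-- Subadditivity of the power r ≤ 1 on a = (a − b) + b. With r = 1/p it converts L¹-closeness of
densities into L^p-closeness of their p-th roots. -/
theorem abs_rpow_sub_rpow_le {a b r : ℝ} (ha : 0 ≤ a) (hb : 0 ≤ b) (hr0 : 0 ≤ r) (hr1 : r ≤ 1) :
    |a ^ r - b ^ r| ≤ |a - b| ^ r := by
  wlog hab : b ≤ a generalizing a b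
  · rw [abs_sub_comm, abs_sub_comm a]
    exact this hb ha (le_of_not_ge hab)
  rw [abs_of_nonneg (sub_nonneg.2 hab),
    abs_of_nonneg (sub_nonneg.2 (Real.rpow_le_rpow hb hab hr0)), sub_le_iff_le_add]
  simpa using Real.rpow_add_le_add_rpow (sub_nonneg.2 hab) hb hr0 hr1

/-- A strongly measurable family of operators maps measurable functions to measurable
functions. -/
theorem aestronglyMeasurable_clm_apply {𝕜 : Type*} [NormedField 𝕜] [NormedSpace 𝕜 X]
    {T : Ω → X →L[𝕜] X} (hT : ∀ x, StronglyMeasurable fun s => T s x) {f : Ω → X}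
    (hf : AEStronglyMeasurable f μ) : AEStronglyMeasurable (fun s => T s (f s)) μ := by
  have hsimple : ∀ F : SimpleFunc Ω X, StronglyMeasurable fun s => T s (F s) := fun F => by
    -- On each fibre of a simple function only one vector occurs, so the hypothesis on orbits
    -- suffices.
    have : (fun s => T s (F s)) = fun s => ∑ x ∈ F.range, (F ⁻¹' {x}).indicator (T · x) s := by
      ext s
      rw [Finset.sum_eq_single (F s)]
      · exact (Set.indicator_of_mem (s := F ⁻¹' {F s}) rfl (T · (F s))).symm
      · intro x _ hx
        exact Set.indicator_of_notMem (fun h => hx (Eq.symm h)) _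
      · exact fun h => absurd (F.mem_range_self s) h
    rw [this]
    exact Finset.stronglyMeasurable_fun_sum _ fun x _ => (hT x).indicator (F.measurableSet_fiber x)
  obtain ⟨g, hg, hfg⟩ := hf
  refine ⟨fun s => T s (g s), ?_, hfg.mono fun s hs => by simp only [hs]⟩
  exact stronglyMeasurable_of_tendsto atTop (fun n => hsimple (hg.approx n))
    (tendsto_pi_nhds.2 fun s => ((T s).continuous.tendsto _).comp (hg.tendsto_approx s))

end Estimates

section Representation

variable {G : Type*} [TopologicalSpace G] [MeasurableSpace G] {μ : Measure G}
  {X : Type*} [NormedAddCommGroup X] [NormedSpace ℂ X] {φ : G → ℝ} {C : ℝ} {p : ℝ≥0∞}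

theorem norm_weight_smul_le [Group G] {π : G →* (X →L[ℂ] X)} (hC : ∀ t, ‖π t‖ ≤ C)
    (hφ : IsDensity μ φ) (r : ℝ) (s t : G) (x : X) :
    ‖((φ s ^ r : ℝ) : ℂ) • π t x‖ ≤ C * ‖x‖ * |φ s| ^ r := by
  have h0 : 0 ≤ φ s ^ r := Real.rpow_nonneg (hφ.nonneg s) r
  rw [norm_smul, Complex.norm_real, Real.norm_of_nonneg h0, abs_of_nonneg (hφ.nonneg s), mul_comm]
  gcongr
  exact (π t).le_of_opNorm_le (hC t) x

/-- Compact support replaces separability of X or second countability of G; r > 0 ensures 0^r = 0,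
so the weight keeps compact support. -/
theorem stronglyMeasurable_weight_smul [BorelSpace G] (hφ : IsDensity μ φ) {r : ℝ}
    (hr : 0 < r) {f : G → X} (hf : Continuous f) :
    StronglyMeasurable fun s => ((φ s ^ r : ℝ) : ℂ) • f s := by
  refine Continuous.stronglyMeasurable_of_hasCompactSupport ?_ ?_
  · exact (Complex.continuous_ofReal.comp
      (hφ.continuous.rpow_const fun _ => Or.inr hr.le)).smul hf
  · refine HasCompactSupport.smul_right (f := fun s => ((φ s ^ r : ℝ) : ℂ)) ?_
    exact hφ.hasCompactSupport.comp_left (g := fun a : ℝ => ((a ^ r : ℝ) : ℂ))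
      (by simp [Real.zero_rpow hr.ne'])

theorem IsDensity.integral_abs_rpow (hφ : IsDensity μ φ) (r : ℝ) :
    (∫ s, |φ s| ∂μ) ^ r = 1 := by
  simp_rw [abs_of_nonneg (hφ.nonneg _), hφ.integral_eq, Real.one_rpow]

variable [Group G] [BorelSpace G] [IsFiniteMeasureOnCompacts μ]
  {π : G →* (X →L[ℂ] X)}

theorem memLp_orbit (hπ : ∀ x : X, Continuous fun t => π t x) (hC : ∀ t, ‖π t‖ ≤ C)
    (hφ : IsDensity μ φ) (hp0 : p ≠ 0) (hp : p ≠ ∞) (x : X) :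
    MemLp (fun s => ((φ s ^ (1 / p.toReal) : ℝ) : ℂ) • π s x) p μ := by
  have hr : 0 < p.toReal := ENNReal.toReal_pos hp0 hp
  refine ⟨(stronglyMeasurable_weight_smul hφ (by positivity) (hπ x)).aestronglyMeasurable, ?_⟩
  refine (eLpNorm_le_of_ae_le_rpow hp0 hp hφ.integrable
    (ae_of_all _ fun s => norm_weight_smul_le hC hφ _ s s x)).trans_lt ?_
  exact ENNReal.mul_lt_top ENNReal.ofReal_lt_top ENNReal.ofReal_lt_top

/-- The operator `x ↦ φ^{1/p} π(·) x` from `X` to `L^p(μ; X)`. -/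
noncomputable def orbitMap (hπ : ∀ x : X, Continuous fun t => π t x) (hC : ∀ t, ‖π t‖ ≤ C)
    (hφ : IsDensity μ φ) [Fact (1 ≤ p)] (hp0 : p ≠ 0) (hp : p ≠ ∞) : X →L[ℂ] Lp X p μ :=
  LinearMap.mkContinuous
    { toFun x := (memLp_orbit hπ hC hφ hp0 hp x).toLp _
      map_add' x y := by
        rw [← MemLp.toLp_add]
        exact MemLp.toLp_congr _ _ (ae_of_all _ fun s => by simp)
      map_smul' c x := by
        rw [RingHom.id_apply, ← MemLp.toLp_const_smul]
        exact MemLp.toLp_congr _ _ (ae_of_all _ fun s => by simp [smul_comm c]) }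
    C fun x => by
      have hC0 : 0 ≤ C := (norm_nonneg _).trans (hC 1)
      refine (norm_toLp_le_of_ae_le_rpow (C := C * ‖x‖) hp0 hp hφ.integrable (by positivity)
        ?_).trans_eq (by rw [hφ.integral_abs_rpow, mul_one])
      filter_upwards [(memLp_orbit hπ hC hφ hp0 hp x).coeFn_toLp] with s hs
      change ‖(memLp_orbit hπ hC hφ hp0 hp x).toLp _ s‖ ≤ _
      rw [hs]
      exact norm_weight_smul_le hC hφ _ s s x

theorem coeFn_orbitMap (hπ : ∀ x : X, Continuous fun t => π t x) (hC : ∀ t, ‖π t‖ ≤ C)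
    (hφ : IsDensity μ φ) [Fact (1 ≤ p)] (hp0 : p ≠ 0) (hp : p ≠ ∞) (x : X) :
    orbitMap hπ hC hφ hp0 hp x =ᵐ[μ] fun s => ((φ s ^ (1 / p.toReal) : ℝ) : ℂ) • π s x :=
  (memLp_orbit hπ hC hφ hp0 hp x).coeFn_toLp

theorem norm_orbitMap_apply_le (hπ : ∀ x : X, Continuous fun t => π t x) (hC : ∀ t, ‖π t‖ ≤ C)
    (hφ : IsDensity μ φ) [Fact (1 ≤ p)] (hp0 : p ≠ 0) (hp : p ≠ ∞) (x : X) :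
    ‖orbitMap hπ hC hφ hp0 hp x‖ ≤ C * ‖x‖ :=
  ContinuousLinearMap.le_of_opNorm_le _
    (LinearMap.mkContinuous_norm_le _ ((norm_nonneg _).trans (hC 1)) _) x

/-- The orbit map almost intertwines `π` and the right translation. -/
theorem norm_rightTranslate_orbitMap_sub_le [IsTopologicalGroup G] [μ.IsMulRightInvariant]
    (hπ : ∀ x : X, Continuous fun t => π t x) (hC : ∀ t, ‖π t‖ ≤ C)
    (hφ : IsDensity μ φ) [Fact (1 ≤ p)] (hp0 : p ≠ 0) (hp : p ≠ ∞) (t : G) (x : X) :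
    ‖rightTranslate μ ℂ p t (orbitMap hπ hC hφ hp0 hp x) - orbitMap hπ hC hφ hp0 hp (π t x)‖ ≤
      C * ‖x‖ * (∫ s, |φ (s * t) - φ s| ∂μ) ^ (1 / p.toReal) := by
  have hC0 : 0 ≤ C := (norm_nonneg _).trans (hC 1)
  have hp1 : 1 ≤ p := Fact.out
  have hr1 : 1 ≤ p.toReal := by
    rw [← ENNReal.toReal_one]
    exact (ENNReal.toReal_le_toReal ENNReal.one_ne_top hp).2 hp1
  refine norm_toLp_le_of_ae_le_rpow hp0 hp ((hφ.comp_mul_right t).integrable.sub hφ.integrable)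
    (by positivity) ?_
  filter_upwards [Lp.coeFn_sub (rightTranslate μ ℂ p t (orbitMap hπ hC hφ hp0 hp x))
    (orbitMap hπ hC hφ hp0 hp (π t x)), coeFn_orbitMap hπ hC hφ hp0 hp (π t x),
    coeFn_rightTranslate_of_ae_eq μ (𝕜 := ℂ) t (coeFn_orbitMap hπ hC hφ hp0 hp x)] with s h1 h2 h3
  -- Both functions have the vector π(s)π(t)x at s, so only the scalar weights are subtracted.
  rw [h1, Pi.sub_apply, h2, h3, map_mul, mul_apply_eq_comp, ← sub_smul,
    ← Complex.ofReal_sub, norm_smul, Complex.norm_real, Real.norm_eq_abs, mul_comm]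
  gcongr
  · rw [← mul_apply_eq_comp, ← map_mul]
    exact (π (s * t)).le_of_opNorm_le (hC _) x
  · exact abs_rpow_sub_rpow_le (hφ.nonneg _) (hφ.nonneg _) (by positivity)
      ((div_le_one (by positivity)).2 hr1)

/-- Hölder's inequality: the weight φ^{1/r} has L^r norm 1 because φ has integral 1. -/
theorem lintegral_weight_inv_le (hC : ∀ t, ‖π t‖ ≤ C)
    (hφ : IsDensity μ φ) {r : ℝ} (hr : p.toReal.HolderConjugate r) (hp : p ≠ ∞) {f : G → X}
    (hf : MemLp f p μ) :
    ∫⁻ s, ‖((φ s ^ (1 / r) : ℝ) : ℂ) • π s⁻¹ (f s)‖ₑ ∂μ ≤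
      ENNReal.ofReal C * eLpNorm f p μ := by
  have hp0 : p ≠ 0 := by
    rintro rfl
    simpa using hr.pos
  have hw : ∫⁻ s, ENNReal.ofReal (φ s ^ (1 / r)) ^ r ∂μ = 1 := by
    have h1 := hφ.integral_eq
    apply_fun ENNReal.ofReal at h1
    rw [ENNReal.ofReal_one] at h1
    rw [← h1, ofReal_integral_eq_lintegral_ofReal hφ.integrable (ae_of_all _ hφ.nonneg)]
    refine lintegral_congr fun s => ?_
    rw [ENNReal.ofReal_rpow_of_nonneg (Real.rpow_nonneg (hφ.nonneg s) _) hr.symm.nonneg,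
      ← Real.rpow_mul (hφ.nonneg s), one_div_mul_cancel hr.symm.ne_zero, Real.rpow_one]
  calc ∫⁻ s, ‖((φ s ^ (1 / r) : ℝ) : ℂ) • π s⁻¹ (f s)‖ₑ ∂μ
      ≤ ∫⁻ s, ENNReal.ofReal C * (‖f s‖ₑ * ENNReal.ofReal (φ s ^ (1 / r))) ∂μ := by
        refine lintegral_mono fun s => ?_
        rw [← ofReal_norm, ← ofReal_norm, ← ENNReal.ofReal_mul (norm_nonneg _),
          ← ENNReal.ofReal_mul ((norm_nonneg _).trans (hC 1))]
        refine ENNReal.ofReal_le_ofReal ((norm_weight_smul_le hC hφ _ s s⁻¹ (f s)).trans_eq ?_)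
        rw [abs_of_nonneg (hφ.nonneg s), mul_assoc]
    _ = ENNReal.ofReal C * ∫⁻ s, ‖f s‖ₑ * ENNReal.ofReal (φ s ^ (1 / r)) ∂μ :=
        lintegral_const_mul' _ _ ENNReal.ofReal_ne_top
    _ ≤ ENNReal.ofReal C * ((∫⁻ s, ‖f s‖ₑ ^ p.toReal ∂μ) ^ (1 / p.toReal) *
          (∫⁻ s, ENNReal.ofReal (φ s ^ (1 / r)) ^ r ∂μ) ^ (1 / r)) := by
        gcongr
        refine ENNReal.lintegral_mul_le_Lp_mul_Lq μ hr hf.aestronglyMeasurable.enorm ?_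
        exact (hφ.continuous.measurable.pow_const _).ennreal_ofReal.aemeasurable
    _ = ENNReal.ofReal C * eLpNorm f p μ := by
        rw [hw, ENNReal.one_rpow, mul_one, eLpNorm_eq_lintegral_rpow_enorm_toReal hp0 hp]

theorem integrable_weight_inv [IsTopologicalGroup G]
    (hπ : ∀ x : X, Continuous fun t => π t x) (hC : ∀ t, ‖π t‖ ≤ C)
    (hφ : IsDensity μ φ) {r : ℝ} (hr : p.toReal.HolderConjugate r) (hp : p ≠ ∞) {f : G → X}
    (hf : MemLp f p μ) :
    Integrable (fun s => ((φ s ^ (1 / r) : ℝ) : ℂ) • π s⁻¹ (f s)) μ := by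
  refine ⟨aestronglyMeasurable_clm_apply (T := fun s => ((φ s ^ (1 / r) : ℝ) : ℂ) • π s⁻¹)
    (fun x => ?_) hf.aestronglyMeasurable, ?_⟩
  · exact stronglyMeasurable_weight_smul hφ (one_div_pos.2 hr.symm.pos)
      ((hπ x).comp continuous_inv)
  · exact (lintegral_weight_inv_le hC hφ hr hp hf).trans_lt
      (ENNReal.mul_lt_top ENNReal.ofReal_lt_top hf.eLpNorm_lt_top)

/-- The operator `f ↦ ∫ φ(s)^{1/r} π(s⁻¹) f(s) ds` from `L^p(μ; X)` to `X`. -/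
noncomputable def averageMap [IsTopologicalGroup G] (hπ : ∀ x : X, Continuous fun t => π t x)
    (hC : ∀ t, ‖π t‖ ≤ C) (hφ : IsDensity μ φ) {r : ℝ} (hr : p.toReal.HolderConjugate r)
    [Fact (1 ≤ p)] (hp : p ≠ ∞) : Lp X p μ →L[ℂ] X :=
  LinearMap.mkContinuous
    { toFun f := ∫ s, ((φ s ^ (1 / r) : ℝ) : ℂ) • π s⁻¹ (f s) ∂μ
      map_add' f g := by
        rw [← integral_add (integrable_weight_inv hπ hC hφ hr hp (Lp.memLp f))
          (integrable_weight_inv hπ hC hφ hr hp (Lp.memLp g))]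
        refine integral_congr_ae ?_
        filter_upwards [Lp.coeFn_add f g] with s hs
        rw [hs, Pi.add_apply, map_add, smul_add]
      map_smul' c f := by
        rw [RingHom.id_apply, ← integral_smul]
        refine integral_congr_ae ?_
        filter_upwards [Lp.coeFn_smul c f] with s hs
        rw [hs, Pi.smul_apply, map_smul, smul_comm] }
    C fun f => by
      have hC0 : 0 ≤ C := (norm_nonneg _).trans (hC 1)
      rw [← ENNReal.ofReal_le_ofReal_iff (by positivity), ENNReal.ofReal_mul hC0, ofReal_norm,
        Lp.norm_def, ENNReal.ofReal_toReal (Lp.eLpNorm_ne_top f)]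
      exact (enorm_integral_le_lintegral_enorm _).trans
        (lintegral_weight_inv_le hC hφ hr hp (Lp.memLp f))

theorem averageMap_apply [IsTopologicalGroup G]
    (hπ : ∀ x : X, Continuous fun t => π t x)
    (hC : ∀ t, ‖π t‖ ≤ C) (hφ : IsDensity μ φ) {r : ℝ} (hr : p.toReal.HolderConjugate r)
    [Fact (1 ≤ p)] (hp : p ≠ ∞) (f : Lp X p μ) : averageMap hπ hC hφ hr hp f =
      ∫ s, ((φ s ^ (1 / r) : ℝ) : ℂ) • π s⁻¹ (f s) ∂μ := rfl

theorem norm_averageMap_apply_le [IsTopologicalGroup G]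
    (hπ : ∀ x : X, Continuous fun t => π t x)
    (hC : ∀ t, ‖π t‖ ≤ C) (hφ : IsDensity μ φ) {r : ℝ} (hr : p.toReal.HolderConjugate r)
    [Fact (1 ≤ p)] (hp : p ≠ ∞) (f : Lp X p μ) : ‖averageMap hπ hC hφ hr hp f‖ ≤ C * ‖f‖ :=
  ContinuousLinearMap.le_of_opNorm_le _
    (LinearMap.mkContinuous_norm_le _ ((norm_nonneg _).trans (hC 1)) _) f

/-- The operators π(s⁻¹) and π(s) cancel and the weights multiply to φ, leaving ∫ φ(s) x ds = x. -/
theorem averageMap_orbitMap [IsTopologicalGroup G]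
    [CompleteSpace X] (hπ : ∀ x : X, Continuous fun t => π t x)
    (hC : ∀ t, ‖π t‖ ≤ C) (hφ : IsDensity μ φ) {r : ℝ} (hr : p.toReal.HolderConjugate r)
    [Fact (1 ≤ p)] (hp0 : p ≠ 0) (hp : p ≠ ∞) (x : X) :
    averageMap hπ hC hφ hr hp (orbitMap hπ hC hφ hp0 hp x) = x := by
  rw [averageMap_apply]
  have h : ∫ s, φ s • x ∂μ = x := by rw [integral_smul_const, hφ.integral_eq, one_smul]
  conv_rhs => rw [← h]
  refine integral_congr_ae ?_
  filter_upwards [coeFn_orbitMap hπ hC hφ hp0 hp x] with s hs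
  rw [hs, map_smul, ← mul_apply_eq_comp, ← map_mul, inv_mul_cancel, map_one,
    one_apply_eq_self, smul_smul, ← Complex.ofReal_mul,
    ← Real.rpow_add_of_nonneg (hφ.nonneg s) (one_div_nonneg.2 hr.symm.nonneg)
      (one_div_nonneg.2 hr.nonneg), one_div, one_div, add_comm, hr.inv_add_inv_eq_one,
    Real.rpow_one, Complex.coe_smul]

end Representation

end GroupDilation

/-! ### Translations on the ultrapower and the dilation. -/

namespace GroupDilation

theorem Ultraproduct.isometry_map {I : Type*} (𝒰 : Ultrafilter I) {E : I → Type*}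
    [∀ j, NormedAddCommGroup (E j)] [∀ j, NormedSpace ℂ (E j)] (T : ∀ j, E j →ₗᵢ[ℂ] E j) :
    Isometry (map 𝒰 T).toContinuousLinearMap :=
  (map 𝒰 T).isometry

theorem Ultraproduct.isPositiveOperator_map {I : Type*} (𝒰 : Ultrafilter I) {E : I → Type*}
    [∀ j, NormedAddCommGroup (E j)] [∀ j, NormedSpace ℂ (E j)] (T : ∀ j, E j →ₗᵢ[ℂ] E j)
    (D : ∀ j, OrderData (E j)) (hT : ∀ j, ∀ x ∈ (D j).cone, T j x ∈ (D j).cone) :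
    (OrderData.ultraproduct 𝒰 D).IsPositiveOperator
      (Ultraproduct.map 𝒰 T).toContinuousLinearMap := by
  rintro _ ⟨x, hx, rfl⟩
  exact ⟨Ultraproduct.lpMap T x, fun j => hT j _ (hx j), rfl⟩

section Representation

variable {G : Type*} [Group G] [TopologicalSpace G] [IsTopologicalGroup G] [MeasurableSpace G]
  [BorelSpace G] (μ : Measure G) [μ.IsMulRightInvariant] {I : Type*} (𝒰 : Ultrafilter I)
  (X : Type*) [NormedAddCommGroup X] [NormedSpace ℂ X] (p : ℝ≥0∞) [Fact (1 ≤ p)]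

/-- The representation by right translations on an ultrapower of `L^p(μ; X)`. -/
noncomputable def ultrapowerTranslation : G →* (Ultraproduct 𝒰 (fun _ : I => Lp X p μ) →L[ℂ]
    Ultraproduct 𝒰 (fun _ : I => Lp X p μ)) where
  toFun t := (Ultraproduct.map 𝒰 fun _ : I => rightTranslate μ ℂ p t).toContinuousLinearMap
  map_one' := by
    ext z
    obtain ⟨x, rfl⟩ := Ultraproduct.mk_surjective 𝒰 z
    change Ultraproduct.mk 𝒰 _ _ = Ultraproduct.mk 𝒰 _ _
    congr 1
    ext1
    funext j
    exact rightTranslate_one μ _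
  map_mul' s t := by
    ext z
    obtain ⟨x, rfl⟩ := Ultraproduct.mk_surjective 𝒰 z
    change Ultraproduct.mk 𝒰 _ _ = Ultraproduct.mk 𝒰 _ _
    congr 1
    ext1
    funext j
    exact rightTranslate_mul μ s t _

theorem ultrapowerTranslation_apply (t : G) :
    ultrapowerTranslation μ 𝒰 X p t =
      (Ultraproduct.map 𝒰 fun _ : I => rightTranslate μ ℂ p t).toContinuousLinearMap := rfl

variable {X p}

theorem isometry_ultrapowerTranslation (t : G) : Isometry (ultrapowerTranslation μ 𝒰 X p t) := by
  rw [ultrapowerTranslation_apply]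
  exact Ultraproduct.isometry_map 𝒰 _

theorem rightTranslate_mem_bochner_cone (D : OrderData X) (t : G) {f : Lp X p μ}
    (hf : f ∈ (D.bochner p μ).cone) : rightTranslate μ ℂ p t f ∈ (D.bochner p μ).cone := by
  rw [OrderData.mem_bochner_cone] at hf ⊢
  filter_upwards [coeFn_rightTranslate μ (𝕜 := ℂ) t f,
    (measurePreserving_mul_right μ t).quasiMeasurePreserving.ae hf] with s h1 h2
  rwa [h1]

theorem isPositiveOperator_ultrapowerTranslation (D : OrderData X) (t : G) :
    (OrderData.ultraproduct 𝒰 fun _ : I => D.bochner p μ).IsPositiveOperator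
      (ultrapowerTranslation μ 𝒰 X p t) := by
  rw [ultrapowerTranslation_apply]
  exact Ultraproduct.isPositiveOperator_map 𝒰 _ (fun _ => D.bochner p μ)
    fun _ f hf => rightTranslate_mem_bochner_cone μ D t hf

/-- For an amenable group, a bounded continuous representation is intertwined with the right
translations on an ultrapower of `L^p(μ; X)`. -/
theorem exists_intertwining_ultrapowerTranslation [LocallyCompactSpace G] [T2Space G] [μ.Regular]
    [NeZero μ] [CompleteSpace X] (hG : IsAmenable G) {π : G →* (X →L[ℂ] X)}
    (hπ : ∀ x : X, Continuous fun t => π t x) {C : ℝ} (hC : ∀ t, ‖π t‖ ≤ C) (hp : 1 < p)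
    (hp' : p < ∞) :
    ∃ (𝒰 : Ultrafilter (Finset G × ℕ))
      (J : X →L[ℂ] Ultraproduct 𝒰 (fun _ : Finset G × ℕ => Lp X p μ))
      (Q : Ultraproduct 𝒰 (fun _ : Finset G × ℕ => Lp X p μ) →L[ℂ]
        StrongDual ℂ (StrongDual ℂ X)),
      ‖J‖ ≤ C ∧ ‖Q‖ ≤ C ∧ (∀ t x, ultrapowerTranslation μ 𝒰 X p t (J x) = J (π t x)) ∧
      ∀ x, Q (J x) = NormedSpace.inclusionInDoubleDual ℂ X x := by
  classical
  have hC0 : 0 ≤ C := (norm_nonneg _).trans (hC 1)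
  have hp0 : p ≠ 0 := (zero_lt_one.trans hp).ne'
  have hpr : 1 < p.toReal := by
    rw [← ENNReal.toReal_one]
    exact (ENNReal.toReal_lt_toReal ENNReal.one_ne_top hp'.ne).2 hp
  have hr := Real.HolderConjugate.conjExponent hpr
  -- The index (F, n) carries a density that is 1/(n+1)-invariant in L¹ under every element of F.
  choose φ hφ hφF using fun j : Finset G × ℕ =>
    exists_isDensity_integral_translate_sub_le μ hG j.1
      (Nat.one_div_pos_of_nat (α := ℝ) (n := j.2))
  let 𝒰 : Ultrafilter (Finset G × ℕ) := Ultrafilter.of atTop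
  have h𝒰 : (𝒰 : Filter (Finset G × ℕ)) ≤ atTop := Ultrafilter.of_le atTop
  let A : Finset G × ℕ → X →L[ℂ] Lp X p μ := fun j =>
    orbitMap hπ hC (hφ j) hp0 hp'.ne
  let B : Finset G × ℕ → Lp X p μ →L[ℂ] X := fun j =>
    averageMap hπ hC (hφ j) hr hp'.ne
  have hA : ∀ j x, ‖A j x‖ ≤ C * ‖x‖ := fun j =>
    norm_orbitMap_apply_le hπ hC (hφ j) hp0 hp'.ne
  have hB : ∀ j f, ‖B j f‖ ≤ C * ‖f‖ := fun j =>
    norm_averageMap_apply_le hπ hC (hφ j) hr hp'.ne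
  let J := Ultraproduct.pi 𝒰 A C hA
  let Q := Ultraproduct.weakLimit 𝒰 B C hC0 hB
  have hint : ∀ t x, ultrapowerTranslation μ 𝒰 X p t (J x) = J (π t x) :=
      fun t x => by
    refine (Ultraproduct.mk_eq_mk_iff 𝒰).2 (Tendsto.mono_left ?_ h𝒰)
    have hlim : Tendsto (fun j : Finset G × ℕ =>
        C * ‖x‖ * (1 / ((j.2 : ℝ) + 1)) ^ (1 / p.toReal)) atTop (𝓝 0) := by
      have h1 : Tendsto (fun j : Finset G × ℕ => 1 / ((j.2 : ℝ) + 1)) atTop (𝓝 0) := by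
        refine tendsto_one_div_add_atTop_nhds_zero_nat.comp ?_
        rw [← prod_atTop_atTop_eq]
        exact tendsto_snd
      have h2 := (h1.rpow_const (p := 1 / p.toReal) (Or.inr (by positivity))).const_mul (C * ‖x‖)
      rwa [Real.zero_rpow (by positivity), mul_zero] at h2
    refine squeeze_zero' (Eventually.of_forall fun j =>
    norm_nonneg _) ?_ hlim
    -- Beyond this index the finite set contains t, so the invariance estimate applies to t.
    filter_upwards [eventually_ge_atTop (({t} : Finset G), 0)] with j hj
    refine (norm_rightTranslate_orbitMap_sub_le hπ hC (hφ j) hp0 hp'.ne t x).trans ?_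
    gcongr
    exact hφF j t (hj.1 (Finset.mem_singleton_self t))
  have hQJ : ∀ x, Q (J x) = NormedSpace.inclusionInDoubleDual ℂ X x := fun x => by
    ext ℓ
    refine Tendsto.limUnder_eq (tendsto_const_nhds.congr fun j => ?_)
    exact congrArg ℓ (averageMap_orbitMap hπ hC (hφ j) hr hp0 hp'.ne x).symm
  exact ⟨𝒰, J, Q, Ultraproduct.norm_pi_le 𝒰 A C hC0 hA,
    Ultraproduct.norm_weakLimit_le 𝒰 B C hC0 hB, hint, hQJ⟩

end Representation

end GroupDilation

theorem mainTheorem8 {G : Type u} [Group G] [TopologicalSpace G] [IsTopologicalGroup G]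
    [LocallyCompactSpace G] [T2Space G] [MeasurableSpace G] [BorelSpace G]
    (hG : GroupDilation.IsAmenable G)
    -- a right Haar measure on `G`
    (μ : Measure G) [μ.Regular] [μ.IsMulRightInvariant] [NeZero μ]
    {X : Type v} [NormedAddCommGroup X] [NormedSpace ℂ X] [CompleteSpace X]
    -- a bounded continuous representation of `G` on `X`
    (π : G →* (X →L[ℂ] X)) (hπ : ∀ x : X, Continuous fun t => π t x)
    (hbdd : BddAbove (Set.range fun t => ‖π t‖))
    (p : ℝ≥0∞) [Fact (1 ≤ p)] (hp : 1 < p) (hp' : p < ∞) :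
    ∃ (I : Type u) (𝒰 : Ultrafilter I)
      (πhat : G →* (GroupDilation.Ultraproduct 𝒰 (fun _ : I => Lp X p μ) →L[ℂ]
        GroupDilation.Ultraproduct 𝒰 (fun _ : I => Lp X p μ)))
      (J : X →L[ℂ] GroupDilation.Ultraproduct 𝒰 (fun _ : I => Lp X p μ))
      (Q : GroupDilation.Ultraproduct 𝒰 (fun _ : I => Lp X p μ) →L[ℂ]
        StrongDual ℂ (StrongDual ℂ X)),
      (∀ t, Isometry (πhat t)) ∧
      ‖J‖ * ‖Q‖ ≤ (⨆ t, ‖π t‖) ^ 2 ∧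
      (∀ t, (NormedSpace.inclusionInDoubleDual ℂ X).comp (π t) = Q.comp ((πhat t).comp J)) ∧
      (∀ x, Continuous fun t => πhat t (J x)) ∧
      ∀ D : GroupDilation.OrderData X, D.IsRieszNormed →
        (GroupDilation.OrderData.ultraproduct 𝒰 (fun _ : I => D.bochner p μ)).IsRieszNormed ∧
        ∀ t, (GroupDilation.OrderData.ultraproduct 𝒰
          (fun _ : I => D.bochner p μ)).IsPositiveOperator (πhat t) := by
  have hC : ∀ t, ‖π t‖ ≤ ⨆ t, ‖π t‖ := fun t => le_ciSup hbdd t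
  obtain ⟨𝒰, J, Q, hJ, hQ, hint, hQJ⟩ :=
    GroupDilation.exists_intertwining_ultrapowerTranslation μ hG hπ hC hp hp'
  refine ⟨Finset G × ℕ, 𝒰, GroupDilation.ultrapowerTranslation μ 𝒰 X p, J, Q, fun t => ?_, ?_,
    fun t => ?_, fun x => ?_, fun D hD => ⟨?_, fun t => ?_⟩⟩
  · exact GroupDilation.isometry_ultrapowerTranslation μ 𝒰 t
  · rw [sq]
    have h0 := (norm_nonneg _).trans (hC 1)
    gcongr
  · ext1 x
    simp only [ContinuousLinearMap.comp_apply]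
    rw [hint, hQJ]
  -- Translations on the ultrapower need not be strongly continuous, but on the range of J they move
  -- along orbits of π.
  · simp_rw [hint]
    exact J.continuous.comp (hπ x)
  · exact GroupDilation.OrderData.IsRieszNormed.ultraproduct 𝒰 fun _ => hD.bochner hp'.ne
  · exact GroupDilation.isPositiveOperator_ultrapowerTranslation μ 𝒰 D t
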